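/- Let $0<q<1$ and $b\in\mathbb{C}$ with $\lambda=\operatorname{Re} b>0$; put $\eta_q=-\operatorname{Im}(b)\ln q$, $q^{s}=e^{s\ln q}$, $(a;q)_n=\prod_{j=0}^{n-1}(1-aq^j)$, $(a;q)_\infty=\prod_{j\ge 0}(1-aq^j)$ and $${}_2\phi_1(\alpha,\beta;c;q,z)=\sum_{k\ge 0}\frac{(\alpha;q)_k(\beta;q)_k}{(c;q)_k(q;q)_k}z^k .$$ For a nontrivial finite positive measure $\mu$ on the unit circle $\mathbb{T}$ let $\varphi_n(\cdot;\mu)=\kappa_n\Phi_n(\cdot;\mu)$ ($\kappa_n>0$, $\Phi_n$ monic of degree $n$) be the orthonormal polynomials, and let $$K_n(z,w;\mu)=\sum_{j=0}^n\overline{\varphi_j(w;\mu)}\,\varphi_j(z;\mu),\qquad \alpha_n=-\overline{\Phi_{n+1}(0;\mu)},\qquad \tau_n=\frac{\Phi_n(1;\mu)}{\Phi_n^*(1;\mu)},$$ where $\Phi_n^*(z)=z^n\overline{\Phi_n(1/\overline z)}$. Put $$g_n=\frac12\,\frac{|1-\tau_{n-1}\alpha_{n-1}|^2}{1-\operatorname{Re}(\tau_{n-1}\alpha_{n-1})}\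 (n\ge 1),\qquad \xi_n=\mu(\mathbb{T})\prod_{j=1}^n 2(1-g_j),\qquad R_n(z;\mu)=\xi_n\,K_n(z,1;\mu).$$ Let $\mu^{(b)}$ be the measure on $\mathbb{T}$ $$d\mu^{(b)}(\zeta)=\rho^{(b)}\frac{|(q\zeta;q)_\infty|^2}{|(q^b\zeta;q)_\infty|^2}\frac{d\zeta}{2\pi i\zeta},\qquad \rho^{(b)}=\frac{1-q^{\overline b}}{{}_2\phi_1(q,q^{-b+1};q^{\overline b+1};q,q^b)}\,\frac{(q;q)_\infty(q^{b+\overline b};q)_\infty}{(q^b;q)_\infty(q^{\overline b};q)_\infty}.$$ Then for all $n\ge 0$ and $z\in\mathbb{C}$, $$R_n(z;\mu^{(b)})=\frac{(q^{\overline b};q)_n}{(q^\lambda\cos\eta_q;q)_n}\;{}_2\phi_1\big(q^{-n},q^b;q^{-\overline b-n+1};q,q^{-\overline b+1}z\big),$$ and, with $G_2(z)=-q^{-\overline b}(z-q^{-b})(z-q^{\overline b})$, $$\gamma_n^{(b)}G_2(z)R_n(z;\mu^{(b+1)})=R_{n+2}(z;\mu^{(b)})+a_1^{(n)}R_{n+1}(z;\mu^{(b)})+a_2^{(n)}\,z\,R_n(z;\mu^{(b)}),$$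 where $$a_1^{(n)}=\frac{1-q^{2\lambda+n+1}}{1-q^{\lambda+n+1}\cos\eta_q}\,\frac{2i\,q^\lambda\sin\eta_q}{q^b(1-q^{\overline b})},$$ $$a_2^{(n)}=\frac{(1-q^{2\lambda+n})(1-q^{2\lambda+n+1})}{(1-q^{\lambda+n}\cos\eta_q)(1-q^{\lambda+n+1}\cos\eta_q)}\,\frac{1-q^{-b}}{1-q^{\overline b}},$$ $$\gamma_n^{(b)}=-q^{\overline b}\,\frac{1-q^{b+n+1}}{1-q^{\lambda+n+1}\cos\eta_q}\,\frac{1-q^b}{1-q^\lambda\cos\eta_q}.$$ -/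

import Mathlib

open MeasureTheory Polynomial

noncomputable section

namespace UnitCircle

/-! Orthogonal polynomials and Christoffel-Darboux kernels of a measure on the unit circle.
A measure on the unit circle is a measure on `ℂ` that is carried by the circle. -/

/-- The pairing `∫ conj (f ζ) * g ζ dμ(ζ)` of two polynomials. -/
def pairing (μ : Measure ℂ) (f g : ℂ[X]) : ℂ :=
  ∫ ζ, (starRingEnd ℂ) (f.eval ζ) * g.eval ζ ∂μ

/-- The monic orthogonal polynomials `Φ_n(·; μ)`, obtained from `1, z, z², …` by the Gram-Schmidt
process. -/
def monicOPUC (μ : Measure ℂ) (n : ℕ) : ℂ[X] :=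
  X ^ n - ∑ k : Fin n,
    C (pairing μ (monicOPUC μ k) (X ^ n) / pairing μ (monicOPUC μ k) (monicOPUC μ k)) *
      monicOPUC μ k
termination_by n
decreasing_by all_goals exact k.isLt

/-- The leading coefficient `κ_n(μ) > 0` of the orthonormal polynomial of degree `n`, that is, the
reciprocal of the `L²(μ)` norm of `Φ_n`. -/
def kappa (μ : Measure ℂ) (n : ℕ) : ℝ :=
  (Real.sqrt (∫ ζ, ‖(monicOPUC μ n).eval ζ‖ ^ 2 ∂μ))⁻¹

/-- The orthonormal polynomials `φ_n(·; μ) = κ_n Φ_n`. -/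
def orthonormalOPUC (μ : Measure ℂ) (n : ℕ) : ℂ[X] :=
  C (kappa μ n : ℂ) * monicOPUC μ n

/-- The kernels `K_n(z, w; μ) = ∑_{j=0}^n conj (φ_j(w)) φ_j(z)`. -/
def cdKernel (μ : Measure ℂ) (n : ℕ) (z w : ℂ) : ℂ :=
  ∑ j ∈ Finset.range (n + 1),
    (starRingEnd ℂ) ((orthonormalOPUC μ j).eval w) * (orthonormalOPUC μ j).eval z

/-- The conjugate-reciprocal polynomial `p*(z) = z ^ deg p * conj (p (1 / conj z))`. -/
def conjReverse (p : ℂ[X]) : ℂ[X] := (p.map (starRingEnd ℂ)).reverse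

/-- The Verblunsky coefficients `α_n(μ) = - conj (Φ_{n+1}(0))`. -/
def verblunsky (μ : Measure ℂ) (n : ℕ) : ℂ :=
  -(starRingEnd ℂ) ((monicOPUC μ (n + 1)).eval 0)

/-- The numbers `τ_n(μ) = Φ_n(1) / Φ_n*(1)`. -/
def tau (μ : Measure ℂ) (n : ℕ) : ℂ :=
  (monicOPUC μ n).eval 1 / (conjReverse (monicOPUC μ n)).eval 1

/-- The parameters `g_n(μ)`, used for `n ≥ 1` only. -/
def gParam (μ : Measure ℂ) (n : ℕ) : ℝ :=
  (1 / 2) * (‖1 - tau μ (n - 1) * verblunsky μ (n - 1)‖ ^ 2 /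
    (1 - (tau μ (n - 1) * verblunsky μ (n - 1)).re))

/-- The normalizing factors `ξ_n(μ) = μ(𝕋) ∏_{j=1}^n 2 (1 - g_j(μ))`. -/
def xi (μ : Measure ℂ) (n : ℕ) : ℝ :=
  μ.real Set.univ * ∏ j ∈ Finset.Icc 1 n, (2 * (1 - gParam μ j))

/-- The normalized kernels `R_n(z; μ) = ξ_n(μ) K_n(z, 1; μ)`. -/
def normalizedKernel (μ : Measure ℂ) (n : ℕ) (z : ℂ) : ℂ :=
  (xi μ n : ℂ) * cdKernel μ n z 1

/-- The normalized arc length measure `dζ / (2 π i ζ) = dθ / (2 π)`, `ζ = exp (i θ)`. -/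
def arcMeasure : Measure ℂ :=
  ENNReal.ofReal (1 / (2 * Real.pi)) •
    (volume.restrict (Set.Ioc 0 (2 * Real.pi))).map (fun θ : ℝ => Complex.exp (Complex.I * θ))

end UnitCircle

namespace QSeries

/-- The finite `q`-shifted factorial `(a; q)_n`. -/
def qPoch (a : ℂ) (q : ℝ) (n : ℕ) : ℂ := ∏ j ∈ Finset.range n, (1 - a * (q : ℂ) ^ j)

/-- The infinite `q`-shifted factorial `(a; q)_∞`. -/
def qPochInf (a : ℂ) (q : ℝ) : ℂ := ∏' j : ℕ, (1 - a * (q : ℂ) ^ j)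

/-- The basic hypergeometric series `₂φ₁(a, b; c; q, z)`. When the series terminates because
`a = q ^ (-n)`, all terms of index larger than `n` are zero. -/
def phi21 (a b c : ℂ) (q : ℝ) (z : ℂ) : ℂ :=
  ∑' k : ℕ, qPoch a q k * qPoch b q k / (qPoch c q k * qPoch q q k) * z ^ k

/-- The constant `ρ^(b)` (a positive real number). -/
def rho (q : ℝ) (b : ℂ) : ℂ :=
  (1 - (q : ℂ) ^ (starRingEnd ℂ b)) /
      phi21 q ((q : ℂ) ^ (-b + 1)) ((q : ℂ) ^ (starRingEnd ℂ b + 1)) q ((q : ℂ) ^ b) *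
    (qPochInf q q * qPochInf ((q : ℂ) ^ (b + starRingEnd ℂ b)) q /
      (qPochInf ((q : ℂ) ^ b) q * qPochInf ((q : ℂ) ^ (starRingEnd ℂ b)) q))

/-- The measure `μ^(b)`, with density `ρ^(b) |(qζ; q)_∞|² / |(q^b ζ; q)_∞|²` with respect to
`dζ / (2 π i ζ)`. -/
def qMeasure (q : ℝ) (b : ℂ) : Measure ℂ :=
  UnitCircle.arcMeasure.withDensity fun ζ : ℂ =>
    ENNReal.ofReal ((rho q b).re *
      (‖qPochInf ((q : ℂ) * ζ) q‖ ^ 2 / ‖qPochInf ((q : ℂ) ^ b * ζ) q‖ ^ 2))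

/-- `η_q = η ln q` with `η = - Im b`. -/
def etaQ (q : ℝ) (b : ℂ) : ℝ := -b.im * Real.log q

/-- The explicit polynomials
`(q^b̄; q)_n / (q^λ cos η_q; q)_n * ₂φ₁(q^{-n}, q^b; q^{-b̄-n+1}; q, q^{-b̄+1} z)`, `λ = Re b`. -/
def explicitKernel (q : ℝ) (b : ℂ) (n : ℕ) (z : ℂ) : ℂ :=
  qPoch ((q : ℂ) ^ (starRingEnd ℂ b)) q n /
      qPoch ((q ^ b.re * Real.cos (etaQ q b) : ℝ) : ℂ) q n *
    phi21 ((q : ℂ) ^ (-(n : ℂ))) ((q : ℂ) ^ b) ((q : ℂ) ^ (-(starRingEnd ℂ b) - (n : ℂ) + 1)) q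
      ((q : ℂ) ^ (-(starRingEnd ℂ b) + 1) * z)

/-- The polynomial `-z₂⁻¹ (z - z₁) (z - z₂)`. -/
def quadG (z₁ z₂ z : ℂ) : ℂ := -z₂⁻¹ * (z - z₁) * (z - z₂)

/-- The coefficient `a_1^(n)`. -/
def coeffA1 (q : ℝ) (b : ℂ) (n : ℕ) : ℂ :=
  (((1 - q ^ (2 * b.re + n + 1)) / (1 - q ^ (b.re + n + 1) * Real.cos (etaQ q b)) : ℝ) : ℂ) *
    (2 * Complex.I * ((q ^ b.re * Real.sin (etaQ q b) : ℝ) : ℂ) /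
      ((q : ℂ) ^ b * (1 - (q : ℂ) ^ (starRingEnd ℂ b))))

/-- The coefficient `a_2^(n)`. -/
def coeffA2 (q : ℝ) (b : ℂ) (n : ℕ) : ℂ :=
  (((1 - q ^ (2 * b.re + n)) * (1 - q ^ (2 * b.re + n + 1)) /
      ((1 - q ^ (b.re + n) * Real.cos (etaQ q b)) *
        (1 - q ^ (b.re + n + 1) * Real.cos (etaQ q b))) : ℝ) : ℂ) *
    ((1 - (q : ℂ) ^ (-b)) / (1 - (q : ℂ) ^ (starRingEnd ℂ b)))

/-- The factor `γ_n^(b)`. -/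
def gammaCoeff (q : ℝ) (b : ℂ) (n : ℕ) : ℂ :=
  -(q : ℂ) ^ (starRingEnd ℂ b) *
    ((1 - (q : ℂ) ^ (b + (n : ℂ) + 1)) /
      ((1 - q ^ (b.re + n + 1) * Real.cos (etaQ q b) : ℝ) : ℂ)) *
    ((1 - (q : ℂ) ^ b) / ((1 - q ^ b.re * Real.cos (etaQ q b) : ℝ) : ℂ))

end QSeries

end

/-! Put `a = q^b`, so `|a| < 1`, and `F(ζ) = (qζ;q)_∞/(aζ;q)_∞`; up to a positive constant the
weight of `μ^(b)` is `|F|²`. The kernel `K_n(·,1)` is characterised, up to a factor, as a polynomial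
of degree at most `n` whose pairing with every `f` of degree at most `n` is a multiple of `f(1)`.
Such a polynomial is exhibited explicitly and then normalised.

The functional equation `(1-aζ)F(ζ) = (1-qζ)F(qζ)` and its conjugate show that the differences `u_k`
of consecutive Fourier coefficients of `|F|²` satisfy the first-order recurrence
`weightDiff_recurrence`. The candidate `kernelPoly` has coefficients `(a;q)_j (conj a;q)_{n-j} /
((q;q)_j (q;q)_{n-j})`. Its pairings with `X^(k+1)` and `X^k` differ by a convolution of these
coefficients with `u`, which vanishes by a telescoping identity (`sum_qBinom_mul_eq_zero`). Hence
its pairings with `1, X, ..., X^n` agree, and it is a real multiple of `K_n(·,1)`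
(`exists_cdKernel_qMeasure_eq`).

The factors `2(1-g_n)` are exactly those for which `2(1-g_{n+1}) Re(K_{n+1}(0,1)/K_n(0,1)) = 1`
(`re_two_mul_one_sub_gParam`). For the explicit polynomials this ratio is a real multiple of `1 -
conj a q^n`, whose real part is `1 - q^(λ+n) cos η_q`; hence the denominator `(q^λ cos η_q;q)_n`
(`normalizedKernel_qMeasure`). Reversing the finite products turns `kernelPoly` into the terminating
`₂φ₁`.

The density is built from the real part of `ρ^(b)`, so its positivity has to be established. It
follows from `ρ^(b) ∫|F|² = 1` (`rho_mul_circleCoeff`), which rests on the constant of Ramanujan's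
`₁ψ₁` sum (`weightDiff_zero`).

The passage from `b` to `b+1` replaces `(a, conj a)` by `(aq, conj a q)`. The generating function of
`kernelPoly` is multiplied by two linear factors and also obeys a `q`-difference equation;
eliminating between these gives `kernelPoly_connection`, which becomes the stated formula after
normalisation. -/

noncomputable section

/-! ### Orthogonal polynomials on the circle, reproducing kernels and their normalisation. -/

namespace UnitCircle

open ComplexConjugate

/-! ### The pairing of a measure on the unit circle -/

theorem integrable_of_continuous {μ : Measure ℂ} [IsFiniteMeasure μ]
    (hT : ∀ᵐ ζ ∂μ, ‖ζ‖ = 1) {F : ℂ → ℂ} (hF : Continuous F) : Integrable F μ := by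
  obtain ⟨M, hM⟩ := (isCompact_sphere (0 : ℂ) 1).exists_bound_of_continuousOn hF.continuousOn
  refine Integrable.of_bound hF.aestronglyMeasurable M ?_
  filter_upwards [hT] with ζ hζ using hM ζ (by simpa using hζ)

theorem continuous_pairing_integrand (f g : ℂ[X]) :
    Continuous fun ζ : ℂ => conj (f.eval ζ) * g.eval ζ :=
  (Complex.continuous_conj.comp f.continuous).mul g.continuous

theorem pairing_conj (μ : Measure ℂ) (f g : ℂ[X]) :
    conj (pairing μ f g) = pairing μ g f := by
  unfold pairing
  rw [← integral_conj]
  congr 1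
  ext ζ
  simp [mul_comm]

/-- The pairing as a linear functional of its second argument. -/
def pairingLin (μ : Measure ℂ) [IsFiniteMeasure μ] (hT : ∀ᵐ ζ ∂μ, ‖ζ‖ = 1) (f : ℂ[X]) :
    ℂ[X] →ₗ[ℂ] ℂ where
  toFun := pairing μ f
  map_add' g h := by
    unfold pairing
    rw [← integral_add (integrable_of_continuous hT (continuous_pairing_integrand f g))
      (integrable_of_continuous hT (continuous_pairing_integrand f h))]
    simp [mul_add]
  map_smul' c g := by
    unfold pairing
    rw [RingHom.id_apply, smul_eq_mul, ← integral_const_mul]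
    congr 1
    ext ζ
    simp only [eval_smul, smul_eq_mul]
    ring

section General

variable {μ : Measure ℂ}

theorem pairing_add_right [IsFiniteMeasure μ] (hT : ∀ᵐ ζ ∂μ, ‖ζ‖ = 1) (f g h : ℂ[X]) :
    pairing μ f (g + h) = pairing μ f g + pairing μ f h :=
  (pairingLin μ hT f).map_add g h

theorem pairing_sub_right [IsFiniteMeasure μ] (hT : ∀ᵐ ζ ∂μ, ‖ζ‖ = 1) (f g h : ℂ[X]) :
    pairing μ f (g - h) = pairing μ f g - pairing μ f h :=
  (pairingLin μ hT f).map_sub g h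

theorem pairing_C_mul_right [IsFiniteMeasure μ] (hT : ∀ᵐ ζ ∂μ, ‖ζ‖ = 1) (f g : ℂ[X]) (c : ℂ) :
    pairing μ f (C c * g) = c * pairing μ f g := by
  rw [← smul_eq_C_mul]
  exact (pairingLin μ hT f).map_smul c g

theorem pairing_sum_right [IsFiniteMeasure μ] (hT : ∀ᵐ ζ ∂μ, ‖ζ‖ = 1) {ι : Type*} (s : Finset ι) (f : ℂ[X])
    (g : ι → ℂ[X]) : pairing μ f (∑ i ∈ s, g i) = ∑ i ∈ s, pairing μ f (g i) :=
  map_sum (pairingLin μ hT f) g s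

theorem pairing_C_mul_left [IsFiniteMeasure μ] (hT : ∀ᵐ ζ ∂μ, ‖ζ‖ = 1) (f g : ℂ[X]) (c : ℂ) :
    pairing μ (C c * f) g = conj c * pairing μ f g := by
  rw [← pairing_conj, pairing_C_mul_right hT, map_mul, pairing_conj]

theorem pairing_self (f : ℂ[X]) :
    pairing μ f f = ((∫ ζ, ‖f.eval ζ‖ ^ 2 ∂μ : ℝ) : ℂ) := by
  unfold pairing
  rw [← integral_complex_ofReal]
  congr 1
  ext ζ
  rw [Complex.conj_mul']
  norm_cast

/-! ### Monic orthogonal polynomials -/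

theorem monicOPUC_monic_and_degree (n : ℕ) :
    (monicOPUC μ n).Monic ∧ (monicOPUC μ n).degree = n := by
  induction n using Nat.strong_induction_on with
  | _ n ih =>
    have h : degree (-∑ k : Fin n,
        C (pairing μ (monicOPUC μ k) (X ^ n) / pairing μ (monicOPUC μ k) (monicOPUC μ k)) *
          monicOPUC μ k) < n := by
      rw [degree_neg]
      refine (degree_sum_le _ _).trans_lt
        ((Finset.sup_lt_iff (WithBot.bot_lt_coe n)).mpr fun k _ => ?_)
      rw [← smul_eq_C_mul]
      refine (degree_smul_le _ _).trans_lt ?_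
      rw [(ih k k.isLt).2]
      exact WithBot.coe_lt_coe.mpr k.isLt
    rw [monicOPUC, sub_eq_add_neg]
    refine ⟨monic_X_pow_add h, ?_⟩
    rw [degree_add_eq_left_of_degree_lt (by simpa using h), degree_X_pow]

theorem monicOPUC_monic (n : ℕ) : (monicOPUC μ n).Monic := (monicOPUC_monic_and_degree n).1

theorem monicOPUC_degree (n : ℕ) : (monicOPUC μ n).degree = n := (monicOPUC_monic_and_degree n).2

theorem monicOPUC_natDegree (n : ℕ) : (monicOPUC μ n).natDegree = n :=
  natDegree_eq_of_degree_eq_some (monicOPUC_degree n)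

/-- This cancellation of the top coefficient drives the inductions on degree below. -/
theorem degree_sub_monicOPUC_lt {f : ℂ[X]} {n : ℕ} (hf : f.degree < ((n + 1 : ℕ) : WithBot ℕ)) :
    (f - C (f.coeff n) * monicOPUC μ n).degree < (n : WithBot ℕ) := by
  rw [degree_lt_iff_coeff_zero] at hf ⊢
  intro m hm
  rcases hm.eq_or_lt with rfl | hm
  · have h1 := monicOPUC_monic (μ := μ) n
    rw [Monic, leadingCoeff, monicOPUC_natDegree] at h1
    simp [h1]
  · rw [coeff_sub, hf m hm, coeff_C_mul, coeff_eq_zero_of_natDegree_lt (p := monicOPUC μ n)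
      (by rw [monicOPUC_natDegree]; exact hm)]
    simp

theorem pairing_monicOPUC_of_lt [IsFiniteMeasure μ] (hT : ∀ᵐ ζ ∂μ, ‖ζ‖ = 1)
    (hpos : ∀ f : ℂ[X], f ≠ 0 → pairing μ f f ≠ 0) {n : ℕ} :
    ∀ k < n, pairing μ (monicOPUC μ k) (monicOPUC μ n) = 0 := by
  induction n using Nat.strong_induction_on with
  | _ n ih =>
    intro k hk
    conv_lhs => rw [monicOPUC.eq_1 μ n]
    rw [pairing_sub_right hT, pairing_sum_right hT,
      Finset.sum_eq_single (⟨k, hk⟩ : Fin n)]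
    · rw [pairing_C_mul_right hT, div_mul_cancel₀ _ (hpos _ (monicOPUC_monic k).ne_zero), sub_self]
    · intro j _ hj
      rw [pairing_C_mul_right hT]
      have hne : (j : ℕ) ≠ k := fun h => hj (Fin.ext h)
      rcases lt_or_gt_of_ne hne with h | h
      · rw [← pairing_conj μ (monicOPUC μ j) (monicOPUC μ k), ih k hk j h, map_zero, mul_zero]
      · rw [ih j j.isLt k h, mul_zero]
    · simp

theorem pairing_monicOPUC_of_degree_lt [IsFiniteMeasure μ] (hT : ∀ᵐ ζ ∂μ, ‖ζ‖ = 1)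
    (hpos : ∀ f : ℂ[X], f ≠ 0 → pairing μ f f ≠ 0) {n : ℕ} {f : ℂ[X]}
    (hf : f.degree < (n : WithBot ℕ)) : pairing μ (monicOPUC μ n) f = 0 := by
  suffices h : ∀ d ≤ n, ∀ f : ℂ[X], f.degree < (d : WithBot ℕ) →
      pairing μ (monicOPUC μ n) f = 0 from h n le_rfl f hf
  intro d
  induction d with
  | zero =>
    intro _ f hf
    have : f = 0 := by simpa using hf
    rw [this]
    exact (pairingLin μ hT _).map_zero
  | succ d ih =>
    intro hd f hf
    have h := ih (by omega) _ (degree_sub_monicOPUC_lt (μ := μ) hf)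
    rw [pairing_sub_right hT, pairing_C_mul_right hT, ← pairing_conj μ (monicOPUC μ d),
      pairing_monicOPUC_of_lt hT hpos d (by omega)] at h
    simpa using h

/-! ### Orthonormal polynomials and kernels -/

theorem normSq_pos (hpos : ∀ f : ℂ[X], f ≠ 0 → pairing μ f f ≠ 0) (n : ℕ) :
    0 < ∫ ζ, ‖(monicOPUC μ n).eval ζ‖ ^ 2 ∂μ := by
  refine lt_of_le_of_ne (integral_nonneg fun ζ => by positivity) fun h => ?_
  refine hpos _ (monicOPUC_monic (μ := μ) n).ne_zero ?_
  rw [pairing_self, ← h, Complex.ofReal_zero]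

theorem kappa_pos (hpos : ∀ f : ℂ[X], f ≠ 0 → pairing μ f f ≠ 0) (n : ℕ) : 0 < kappa μ n :=
  inv_pos.mpr (Real.sqrt_pos.mpr (normSq_pos hpos n))

theorem kappa_sq (n : ℕ) :
    kappa μ n ^ 2 = (∫ ζ, ‖(monicOPUC μ n).eval ζ‖ ^ 2 ∂μ)⁻¹ := by
  rw [kappa, inv_pow, Real.sq_sqrt (integral_nonneg fun ζ => by positivity)]

theorem pairing_monicOPUC_self (n : ℕ) :
    pairing μ (monicOPUC μ n) (monicOPUC μ n) = ((kappa μ n : ℂ) ^ 2)⁻¹ := by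
  rw [pairing_self, ← Complex.ofReal_pow, kappa_sq, Complex.ofReal_inv, inv_inv]

theorem eq_sum_orthonormalOPUC [IsFiniteMeasure μ] (hT : ∀ᵐ ζ ∂μ, ‖ζ‖ = 1)
    (hpos : ∀ f : ℂ[X], f ≠ 0 → pairing μ f f ≠ 0) {n : ℕ} {f : ℂ[X]}
    (hf : f.degree < (n : WithBot ℕ)) :
    f = ∑ j ∈ Finset.range n, C (pairing μ (orthonormalOPUC μ j) f) * orthonormalOPUC μ j := by
  induction n generalizing f with
  | zero => simpa using hf
  | succ n ih =>
    have hdeg := degree_sub_monicOPUC_lt (μ := μ) hf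
    set c := f.coeff n
    set g := f - C c * monicOPUC μ n with hg
    have hfg : f = g + C c * monicOPUC μ n := by rw [hg]; ring
    have hκ : (kappa μ n : ℂ) ≠ 0 := by exact_mod_cast (kappa_pos hpos n).ne'
    rw [Finset.sum_range_succ]
    have h1 : ∀ j ∈ Finset.range n, C (pairing μ (orthonormalOPUC μ j) f) * orthonormalOPUC μ j =
        C (pairing μ (orthonormalOPUC μ j) g) * orthonormalOPUC μ j := by
      intro j hj
      rw [hfg, pairing_add_right hT, pairing_C_mul_right hT, orthonormalOPUC,
        pairing_C_mul_left hT _ (monicOPUC μ n),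
        pairing_monicOPUC_of_lt hT hpos j (Finset.mem_range.mp hj)]
      simp
    have h2 : pairing μ (orthonormalOPUC μ n) f = c * (kappa μ n : ℂ)⁻¹ := by
      rw [hfg, pairing_add_right hT, pairing_C_mul_right hT, orthonormalOPUC,
        pairing_C_mul_left hT, pairing_C_mul_left hT, pairing_monicOPUC_of_degree_lt hT hpos hdeg,
        pairing_monicOPUC_self, Complex.conj_ofReal]
      field_simp
      ring
    rw [Finset.sum_congr rfl h1, ← ih hdeg, h2, orthonormalOPUC, ← mul_assoc, ← C_mul,
      mul_assoc, inv_mul_cancel₀ hκ, mul_one]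
    exact hfg

/-- A polynomial that represents a multiple of the evaluation at `w` is a multiple of the
kernel. -/
theorem eval_eq_mul_cdKernel [IsFiniteMeasure μ] (hT : ∀ᵐ ζ ∂μ, ‖ζ‖ = 1)
    (hpos : ∀ f : ℂ[X], f ≠ 0 → pairing μ f f ≠ 0) {n : ℕ} {g : ℂ[X]} {c w : ℂ}
    (hg : g.degree < ((n + 1 : ℕ) : WithBot ℕ))
    (h : ∀ f : ℂ[X], f.degree < ((n + 1 : ℕ) : WithBot ℕ) → pairing μ g f = c * f.eval w) (z : ℂ) :
    g.eval z = conj c * cdKernel μ n z w := by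
  conv_lhs => rw [eq_sum_orthonormalOPUC hT hpos hg]
  rw [eval_finsetSum, cdKernel, Finset.mul_sum]
  refine Finset.sum_congr rfl fun j hj => ?_
  have hdeg : (orthonormalOPUC μ j).degree < ((n + 1 : ℕ) : WithBot ℕ) := by
    rw [orthonormalOPUC, ← smul_eq_C_mul]
    refine (degree_smul_le _ _).trans_lt ?_
    rw [monicOPUC_degree]
    exact_mod_cast Finset.mem_range.mp hj
  rw [eval_mul, eval_C, ← pairing_conj, h _ hdeg, map_mul, mul_assoc]

theorem cdKernel_conj (n : ℕ) (z w : ℂ) : conj (cdKernel μ n z w) = cdKernel μ n w z := by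
  simp only [cdKernel, map_sum, map_mul, Complex.conj_conj]
  exact Finset.sum_congr rfl fun j _ => mul_comm _ _

theorem cdKernel_succ (n : ℕ) (z w : ℂ) :
    cdKernel μ (n + 1) z w = cdKernel μ n z w +
      (kappa μ (n + 1) : ℂ) ^ 2 *
        (conj ((monicOPUC μ (n + 1)).eval w) * (monicOPUC μ (n + 1)).eval z) := by
  rw [cdKernel, Finset.sum_range_succ, ← cdKernel]
  simp only [orthonormalOPUC, eval_mul, eval_C, map_mul, Complex.conj_ofReal]
  ring

/-! ### Reversed polynomials -/

theorem eval_reflect_map_conj {n : ℕ} {f : ℂ[X]} (hf : f.natDegree ≤ n) {ζ : ℂ} (hζ : ‖ζ‖ = 1) :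
    (reflect n (f.map (starRingEnd ℂ))).eval ζ = ζ ^ n * conj (f.eval ζ) := by
  have h0 : conj ζ * ζ = 1 := by rw [Complex.conj_mul', hζ]; simp
  have h1 : ζ * conj ζ = 1 := by rw [mul_comm, h0]
  -- On the circle `ζ` itself inverts `conj ζ`, so that `⅟(conj ζ)` is `ζ` by definition.
  let _ : Invertible (conj ζ) := ⟨ζ, h1, h0⟩
  have h := eval₂_reflect_mul_pow (RingHom.id ℂ) (conj ζ) n (f.map (starRingEnd ℂ))
    (natDegree_map_le.trans hf)
  have h2 : ⅟(conj ζ) = ζ := rfl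
  have h3 : (f.map (starRingEnd ℂ)).eval (conj ζ) = conj (f.eval ζ) := by
    rw [eval_map, ← eval₂_id (p := f) (x := ζ), hom_eval₂, RingHom.comp_id]
  rw [h2, ← eval, ← eval, h3] at h
  rw [← h, mul_comm, mul_assoc, ← mul_pow, h0, one_pow, mul_one]

theorem conjReverse_monicOPUC (n : ℕ) :
    conjReverse (monicOPUC μ n) = reflect n ((monicOPUC μ n).map (starRingEnd ℂ)) := by
  rw [conjReverse, reverse, natDegree_map, monicOPUC_natDegree]

theorem eval_one_conjReverse_monicOPUC (n : ℕ) :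
    (conjReverse (monicOPUC μ n)).eval 1 = conj ((monicOPUC μ n).eval 1) := by
  rw [conjReverse_monicOPUC, eval_reflect_map_conj (monicOPUC_natDegree n).le (by simp)]
  simp

theorem eval_zero_conjReverse_monicOPUC (n : ℕ) :
    (conjReverse (monicOPUC μ n)).eval 0 = 1 := by
  rw [conjReverse, ← coeff_zero_eq_eval_zero, coeff_zero_reverse,
    ((monicOPUC_monic n).map _).leadingCoeff]

/-- On the circle both integrands equal `conj ζ ^ n * f ζ * g ζ`, which is symmetric in `f` and `g`.
-/
theorem pairing_reflect (hT : ∀ᵐ ζ ∂μ, ‖ζ‖ = 1) {n : ℕ} {f g : ℂ[X]} (hf : f.natDegree ≤ n)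
    (hg : g.natDegree ≤ n) :
    pairing μ (reflect n (f.map (starRingEnd ℂ))) g =
      pairing μ (reflect n (g.map (starRingEnd ℂ))) f := by
  refine integral_congr_ae ?_
  filter_upwards [hT] with ζ hζ
  rw [eval_reflect_map_conj hf hζ, eval_reflect_map_conj hg hζ]
  simp only [map_mul, Complex.conj_conj]
  ring

/-- Reflecting both arguments turns this into a pairing of `Φ_n` with the reflection of `f`; only
the coefficient of `X^n` there, which is `conj (f 0)`, survives orthogonality. Thus `Φ_n*`
represents a multiple of evaluation at `0`, whence `K_n(z,0) = κ_n² Φ_n*(z)`. -/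
theorem pairing_conjReverse_monicOPUC [IsFiniteMeasure μ] (hT : ∀ᵐ ζ ∂μ, ‖ζ‖ = 1)
    (hpos : ∀ f : ℂ[X], f ≠ 0 → pairing μ f f ≠ 0) {n : ℕ} {f : ℂ[X]}
    (hf : f.degree < ((n + 1 : ℕ) : WithBot ℕ)) :
    pairing μ (conjReverse (monicOPUC μ n)) f = ((kappa μ n : ℂ) ^ 2)⁻¹ * f.eval 0 := by
  have hf' : f.natDegree ≤ n := by
    rw [natDegree_le_iff_degree_le]
    exact Order.lt_succ_iff.mp hf
  rw [conjReverse_monicOPUC, pairing_reflect hT (monicOPUC_natDegree n).le hf']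
  set g := reflect n (f.map (starRingEnd ℂ)) with hg
  have hgd : g.degree < ((n + 1 : ℕ) : WithBot ℕ) := by
    rw [degree_lt_iff_coeff_zero]
    intro m hm
    rw [hg, coeff_reflect, revAt_eq_self_of_lt (by omega), coeff_map,
      coeff_eq_zero_of_natDegree_lt (by omega), map_zero]
  have hgc : g.coeff n = conj (f.eval 0) := by
    rw [hg, coeff_reflect, revAt_le le_rfl, Nat.sub_self, coeff_map, coeff_zero_eq_eval_zero]
  have h := pairing_monicOPUC_of_degree_lt hT hpos (degree_sub_monicOPUC_lt (μ := μ) hgd)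
  rw [pairing_sub_right hT, pairing_C_mul_right hT, hgc, pairing_monicOPUC_self,
    sub_eq_zero] at h
  rw [← pairing_conj, h, map_mul, Complex.conj_conj, mul_comm]
  simp

theorem cdKernel_zero_right [IsFiniteMeasure μ] (hT : ∀ᵐ ζ ∂μ, ‖ζ‖ = 1)
    (hpos : ∀ f : ℂ[X], f ≠ 0 → pairing μ f f ≠ 0) (n : ℕ) (z : ℂ) :
    cdKernel μ n z 0 = (kappa μ n : ℂ) ^ 2 * (conjReverse (monicOPUC μ n)).eval z := by
  have hκ : (kappa μ n : ℂ) ≠ 0 := by exact_mod_cast (kappa_pos hpos n).ne'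
  have hdeg : (conjReverse (monicOPUC μ n)).degree < ((n + 1 : ℕ) : WithBot ℕ) := by
    rw [conjReverse_monicOPUC, degree_lt_iff_coeff_zero]
    intro m hm
    rw [coeff_reflect, revAt_eq_self_of_lt (by omega), coeff_map,
      coeff_eq_zero_of_natDegree_lt (by rw [monicOPUC_natDegree]; omega), map_zero]
  rw [eval_eq_mul_cdKernel hT hpos hdeg fun f hf => pairing_conjReverse_monicOPUC hT hpos hf]
  simp only [map_inv₀, map_pow, Complex.conj_ofReal]
  field_simp

theorem cdKernel_zero_one [IsFiniteMeasure μ] (hT : ∀ᵐ ζ ∂μ, ‖ζ‖ = 1)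
    (hpos : ∀ f : ℂ[X], f ≠ 0 → pairing μ f f ≠ 0) (n : ℕ) :
    cdKernel μ n 0 1 = (kappa μ n : ℂ) ^ 2 * (monicOPUC μ n).eval 1 := by
  rw [← cdKernel_conj, cdKernel_zero_right hT hpos, eval_one_conjReverse_monicOPUC]
  simp

/-- Compare `K_{n+1}(0,0) = κ_{n+1}²` with `K_n(0,0) = κ_n²`, using `Φ_n*(0) = 1`. -/
theorem kappa_sq_succ_mul [IsFiniteMeasure μ] (hT : ∀ᵐ ζ ∂μ, ‖ζ‖ = 1)
    (hpos : ∀ f : ℂ[X], f ≠ 0 → pairing μ f f ≠ 0) (n : ℕ) :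
    kappa μ (n + 1) ^ 2 * (1 - ‖verblunsky μ n‖ ^ 2) = kappa μ n ^ 2 := by
  have h := cdKernel_succ (μ := μ) n 0 0
  rw [cdKernel_zero_right hT hpos, cdKernel_zero_right hT hpos, eval_zero_conjReverse_monicOPUC,
    eval_zero_conjReverse_monicOPUC, Complex.conj_mul'] at h
  have h2 : ‖verblunsky μ n‖ = ‖(monicOPUC μ (n + 1)).eval 0‖ := by
    rw [verblunsky, norm_neg, RCLike.norm_conj]
  rw [h2]
  have h3 : kappa μ (n + 1) ^ 2 * 1 = kappa μ n ^ 2 * 1 +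
      kappa μ (n + 1) ^ 2 * ‖(monicOPUC μ (n + 1)).eval 0‖ ^ 2 := by exact_mod_cast h
  linarith

/-- The Szegő recursion at `1`, where `Φ_n*(1) = conj (Φ_n(1))`. The increment `K_{n+1}(1,0) -
K_n(1,0)` and its conjugate form a linear system for `Φ_{n+1}(1)` and its conjugate. -/
theorem eval_one_monicOPUC_succ [IsFiniteMeasure μ] (hT : ∀ᵐ ζ ∂μ, ‖ζ‖ = 1)
    (hpos : ∀ f : ℂ[X], f ≠ 0 → pairing μ f f ≠ 0) (n : ℕ) :
    (monicOPUC μ (n + 1)).eval 1 =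
      (monicOPUC μ n).eval 1 - conj (verblunsky μ n) * conj ((monicOPUC μ n).eval 1) := by
  have h := cdKernel_succ (μ := μ) n 1 0
  rw [cdKernel_zero_right hT hpos, cdKernel_zero_right hT hpos, eval_one_conjReverse_monicOPUC,
    eval_one_conjReverse_monicOPUC] at h
  have hα : conj ((monicOPUC μ (n + 1)).eval 0) = -verblunsky μ n := by rw [verblunsky, neg_neg]
  have hk : (kappa μ (n + 1) : ℂ) ^ 2 *
      (1 - verblunsky μ n * conj (verblunsky μ n)) = (kappa μ n : ℂ) ^ 2 := by
    rw [Complex.mul_conj']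
    exact_mod_cast kappa_sq_succ_mul hT hpos n
  have hκ : (kappa μ n : ℂ) ^ 2 ≠ 0 := pow_ne_zero _ (by exact_mod_cast (kappa_pos hpos n).ne')
  rw [hα] at h
  have h' := congrArg conj h
  simp only [map_add, map_mul, map_pow, Complex.conj_ofReal, Complex.conj_conj, map_neg] at h'
  rw [← hk] at hκ
  refine mul_left_cancel₀ hκ ?_
  rw [← hk] at h h'
  linear_combination h' - conj (verblunsky μ n) * h

/-- The defining property of the factors `2 (1 - g_n)`: they normalize the ratios of the kernels
`K_n(0, 1)` to real part one. -/
theorem re_two_mul_one_sub_gParam [IsFiniteMeasure μ] (hT : ∀ᵐ ζ ∂μ, ‖ζ‖ = 1)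
    (hpos : ∀ f : ℂ[X], f ≠ 0 → pairing μ f f ≠ 0) (n : ℕ) (hn : cdKernel μ n 0 1 ≠ 0) :
    2 * (1 - gParam μ (n + 1)) * (cdKernel μ (n + 1) 0 1 / cdKernel μ n 0 1).re = 1 := by
  have hP : (monicOPUC μ n).eval 1 ≠ 0 := by
    intro h
    rw [cdKernel_zero_one hT hpos, h, mul_zero] at hn
    exact hn rfl
  have hcP : conj ((monicOPUC μ n).eval 1) ≠ 0 := by simpa using hP
  have hκ := kappa_pos hpos n
  have hκ' := kappa_pos hpos (n + 1)
  have hk := kappa_sq_succ_mul hT hpos n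
  rw [cdKernel_zero_one hT hpos, cdKernel_zero_one hT hpos, eval_one_monicOPUC_succ hT hpos]
  set P := (monicOPUC μ n).eval 1
  set α := verblunsky μ n with hα
  have ht : tau μ n = P / conj P := by rw [tau, eval_one_conjReverse_monicOPUC]
  have htn : ‖tau μ n‖ = 1 := by
    rw [ht, norm_div, RCLike.norm_conj, div_self (norm_ne_zero_iff.mpr hP)]
  set t := tau μ n * α with htα
  have htnorm : ‖t‖ = ‖α‖ := by rw [htα, norm_mul, htn, one_mul]
  have hα1 : ‖α‖ ^ 2 < 1 := by
    by_contra h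
    have : kappa μ (n + 1) ^ 2 * (1 - ‖α‖ ^ 2) ≤ 0 :=
      mul_nonpos_of_nonneg_of_nonpos (by positivity) (by linarith)
    nlinarith [sq_pos_of_pos hκ]
  have hre : t.re < 1 := by
    refine (Complex.re_le_norm t).trans_lt ?_
    rw [htnorm]
    nlinarith [norm_nonneg α]
  -- By the Szegő recursion the kernel ratio is `conj (1 - τ_n α_n) / (1 - |α_n|²)`. As `|τ_n α_n| =
  -- |α_n|`, expanding `|1 - τ_n α_n|²` gives `2(1-g_{n+1}) = (1 - |α_n|²) / (1 - Re(τ_n α_n))`, the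
  -- reciprocal of its real part.
  have hratio : (kappa μ (n + 1) : ℂ) ^ 2 * (P - conj α * conj P) / ((kappa μ n : ℂ) ^ 2 * P) =
      (((1 - ‖α‖ ^ 2)⁻¹ : ℝ) : ℂ) * conj (1 - t) := by
    have h1 : (1 - ‖α‖ ^ 2 : ℝ) ≠ 0 := by linarith
    have h1' : ((1 - ‖α‖ ^ 2 : ℝ) : ℂ) ≠ 0 := by exact_mod_cast h1
    have h2 : (kappa μ (n + 1) : ℂ) ≠ 0 := by exact_mod_cast hκ'.ne'
    rw [← Complex.ofReal_pow (kappa μ n), ← hk, htα, ht]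
    simp only [map_sub, map_mul, map_div₀, map_one, Complex.conj_conj, Complex.ofReal_mul,
      Complex.ofReal_pow, Complex.ofReal_inv]
    field_simp
  rw [hratio, Complex.re_ofReal_mul, Complex.conj_re, Complex.sub_re, Complex.one_re]
  have hg : gParam μ (n + 1) = 1 / 2 * (‖1 - t‖ ^ 2 / (1 - t.re)) := rfl
  have hnorm : ‖1 - t‖ ^ 2 = 1 - 2 * t.re + ‖α‖ ^ 2 := by
    rw [← htnorm, ← Complex.normSq_eq_norm_sq, ← Complex.normSq_eq_norm_sq, Complex.normSq_apply,
      Complex.normSq_apply]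
    simp only [Complex.sub_re, Complex.one_re, Complex.sub_im, Complex.one_im]
    ring
  rw [hg, hnorm]
  have h3 : 1 - t.re ≠ 0 := by linarith
  have h4 : 1 - ‖α‖ ^ 2 ≠ 0 := by linarith
  field_simp
  ring

end General

end UnitCircle

/-! ### Algebra of the kernel polynomials: generating function, orthogonality sums, terminating
series. -/

namespace QSeries

/-! ### Finite `q`-shifted factorials -/

theorem qPoch_zero (a : ℂ) (q : ℝ) : qPoch a q 0 = 1 := by simp [qPoch]

theorem qPoch_succ (a : ℂ) (q : ℝ) (n : ℕ) :
    qPoch a q (n + 1) = qPoch a q n * (1 - a * (q : ℂ) ^ n) :=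
  Finset.prod_range_succ _ n

theorem qPoch_succ' (a : ℂ) (q : ℝ) (n : ℕ) :
    qPoch a q (n + 1) = (1 - a) * qPoch (a * q) q n := by
  rw [qPoch, Finset.prod_range_succ', mul_comm, pow_zero, mul_one, qPoch]
  congr 1
  exact Finset.prod_congr rfl fun j _ => by ring

theorem one_sub_mul_pow_ne_zero {q : ℝ} (hq0 : 0 < q) (hq1 : q < 1) {a : ℂ} (ha : ‖a‖ < 1)
    (n : ℕ) : 1 - a * (q : ℂ) ^ n ≠ 0 := by
  intro h
  have h1 : ‖a * (q : ℂ) ^ n‖ = 1 := by rw [← sub_eq_zero.mp h, norm_one]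
  rw [norm_mul, norm_pow, Complex.norm_real, Real.norm_of_nonneg hq0.le] at h1
  have h2 : q ^ n ≤ 1 := pow_le_one₀ hq0.le hq1.le
  nlinarith [norm_nonneg a, pow_pos hq0 n]

theorem qPoch_ne_zero {q : ℝ} (hq0 : 0 < q) (hq1 : q < 1) {a : ℂ} (ha : ‖a‖ < 1) (n : ℕ) :
    qPoch a q n ≠ 0 :=
  Finset.prod_ne_zero_iff.mpr fun j _ => one_sub_mul_pow_ne_zero hq0 hq1 ha j

theorem norm_ofReal_lt_one {q : ℝ} (hq0 : 0 < q) (hq1 : q < 1) : ‖(q : ℂ)‖ < 1 := by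
  rwa [Complex.norm_real, Real.norm_of_nonneg hq0.le]

theorem one_sub_pow_succ_ne_zero {q : ℝ} (hq0 : 0 < q) (hq1 : q < 1) (n : ℕ) :
    1 - (q : ℂ) ^ (n + 1) ≠ 0 := by
  rw [pow_succ']
  exact one_sub_mul_pow_ne_zero hq0 hq1 (norm_ofReal_lt_one hq0 hq1) n

/-- The coefficients `(a; q)_n / (q; q)_n` of the `q`-binomial series. -/
def qBinom (a : ℂ) (q : ℝ) (n : ℕ) : ℂ := qPoch a q n / qPoch q q n

theorem qBinom_zero (a : ℂ) (q : ℝ) : qBinom a q 0 = 1 := by simp [qBinom, qPoch_zero]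

theorem qBinom_succ {q : ℝ} (hq0 : 0 < q) (hq1 : q < 1) (a : ℂ) (n : ℕ) :
    (1 - (q : ℂ) ^ (n + 1)) * qBinom a q (n + 1) = (1 - a * (q : ℂ) ^ n) * qBinom a q n := by
  have h1 := qPoch_ne_zero hq0 hq1 (norm_ofReal_lt_one hq0 hq1) n
  have h2 := one_sub_pow_succ_ne_zero hq0 hq1 n
  have h3 : 1 - (q : ℂ) * (q : ℂ) ^ n ≠ 0 := by rwa [← pow_succ']
  rw [qBinom, qBinom, qPoch_succ, qPoch_succ, pow_succ']
  field_simp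

theorem qBinom_succ_eq_sub {q : ℝ} (hq0 : 0 < q) (hq1 : q < 1) (a : ℂ) (n : ℕ) :
    qBinom a q (n + 1) = qBinom (a * q) q (n + 1) - a * qBinom (a * q) q n := by
  have h1 := qPoch_ne_zero hq0 hq1 (norm_ofReal_lt_one hq0 hq1) n
  have h2 := one_sub_pow_succ_ne_zero hq0 hq1 n
  have h3 : 1 - (q : ℂ) * (q : ℂ) ^ n ≠ 0 := by rwa [← pow_succ']
  rw [qBinom, qBinom, qBinom, qPoch_succ', qPoch_succ (a * q), qPoch_succ (q : ℂ)]
  field_simp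
  ring

/-! ### The kernel polynomials and their generating function -/

/-- The polynomials `∑_j (a; q)_j (c; q)_{n-j} / ((q; q)_j (q; q)_{n-j}) z ^ j`. -/
def kernelPoly (q : ℝ) (a c : ℂ) (n : ℕ) (z : ℂ) : ℂ :=
  ∑ j ∈ Finset.range (n + 1), qBinom a q j * qBinom c q (n - j) * z ^ j

/-- The `q`-binomial series as a formal power series. -/
def qBinomSeries (q : ℝ) (a z : ℂ) : PowerSeries ℂ := PowerSeries.mk fun n => qBinom a q n * z ^ n

/-- The generating function of the kernel polynomials. -/
def kernelSeries (q : ℝ) (a c z : ℂ) : PowerSeries ℂ := qBinomSeries q a z * qBinomSeries q c 1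

theorem coeff_kernelSeries (q : ℝ) (a c z : ℂ) (n : ℕ) :
    PowerSeries.coeff n (kernelSeries q a c z) = kernelPoly q a c n z := by
  rw [kernelSeries, PowerSeries.coeff_mul, Finset.Nat.sum_antidiagonal_eq_sum_range_succ_mk,
    kernelPoly]
  refine Finset.sum_congr rfl fun j _ => ?_
  simp only [qBinomSeries, PowerSeries.coeff_mk, one_pow]
  ring

theorem coeff_succ_one_sub_mul (a : ℂ) (F : PowerSeries ℂ) (n : ℕ) :
    PowerSeries.coeff (n + 1) ((1 - PowerSeries.C a * PowerSeries.X) * F) =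
      PowerSeries.coeff (n + 1) F - a * PowerSeries.coeff n F := by
  rw [sub_mul, one_mul, map_sub, mul_assoc, PowerSeries.coeff_C_mul, PowerSeries.coeff_succ_X_mul]

theorem coeff_zero_one_sub_mul (a : ℂ) (F : PowerSeries ℂ) :
    PowerSeries.coeff 0 ((1 - PowerSeries.C a * PowerSeries.X) * F) = PowerSeries.coeff 0 F := by
  rw [sub_mul, one_mul, map_sub, mul_assoc, PowerSeries.coeff_C_mul, PowerSeries.coeff_zero_X_mul,
    mul_zero, sub_zero]

theorem coeff_add_two_one_sub_mul (a c : ℂ) (F : PowerSeries ℂ) (n : ℕ) :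
    PowerSeries.coeff (n + 2) ((1 - PowerSeries.C a * PowerSeries.X) *
        ((1 - PowerSeries.C c * PowerSeries.X) * F)) =
      PowerSeries.coeff (n + 2) F - (a + c) * PowerSeries.coeff (n + 1) F +
        a * c * PowerSeries.coeff n F := by
  rw [coeff_succ_one_sub_mul, coeff_succ_one_sub_mul, coeff_succ_one_sub_mul]
  ring

/-- Formally the series is `(azt;q)_∞/(zt;q)_∞`; replacing `t` by `qt` drops the first factor of
each product. Coefficientwise this is the two-term recurrence of `qBinom`. -/
theorem qBinomSeries_rescale {q : ℝ} (hq0 : 0 < q) (hq1 : q < 1) (a z : ℂ) :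
    (1 - PowerSeries.C z * PowerSeries.X) * qBinomSeries q a z =
      (1 - PowerSeries.C (a * z) * PowerSeries.X) *
        PowerSeries.rescale (q : ℂ) (qBinomSeries q a z) := by
  ext n
  cases n with
  | zero =>
    simp only [coeff_zero_one_sub_mul, PowerSeries.coeff_rescale, pow_zero, one_mul]
  | succ n =>
    rw [coeff_succ_one_sub_mul, coeff_succ_one_sub_mul]
    simp only [PowerSeries.coeff_rescale, qBinomSeries, PowerSeries.coeff_mk]
    linear_combination z ^ (n + 1) * qBinom_succ hq0 hq1 a n

theorem qBinomSeries_shift {q : ℝ} (hq0 : 0 < q) (hq1 : q < 1) (a z : ℂ) :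
    qBinomSeries q a z =
      (1 - PowerSeries.C (a * z) * PowerSeries.X) * qBinomSeries q (a * q) z := by
  ext n
  cases n with
  | zero => simp [qBinomSeries, qBinom_zero]
  | succ n =>
    rw [coeff_succ_one_sub_mul]
    simp only [qBinomSeries, PowerSeries.coeff_mk]
    linear_combination z ^ (n + 1) * qBinom_succ_eq_sub hq0 hq1 a n

theorem kernelSeries_rescale {q : ℝ} (hq0 : 0 < q) (hq1 : q < 1) (a c z : ℂ) :
    (1 - PowerSeries.C z * PowerSeries.X) * ((1 - PowerSeries.C 1 * PowerSeries.X) *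
        kernelSeries q a c z) =
      (1 - PowerSeries.C (a * z) * PowerSeries.X) * ((1 - PowerSeries.C c * PowerSeries.X) *
        PowerSeries.rescale (q : ℂ) (kernelSeries q a c z)) := by
  have h1 := qBinomSeries_rescale hq0 hq1 a z
  have h2 := qBinomSeries_rescale hq0 hq1 c 1
  rw [mul_one] at h2
  rw [kernelSeries, map_mul (PowerSeries.rescale (q : ℂ))]
  calc _ = ((1 - PowerSeries.C z * PowerSeries.X) * qBinomSeries q a z) *
        ((1 - PowerSeries.C 1 * PowerSeries.X) * qBinomSeries q c 1) := by ring
    _ = _ := by rw [h1, h2]; ring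

theorem kernelSeries_shift {q : ℝ} (hq0 : 0 < q) (hq1 : q < 1) (a c z : ℂ) :
    kernelSeries q a c z =
      (1 - PowerSeries.C (a * z) * PowerSeries.X) * ((1 - PowerSeries.C c * PowerSeries.X) *
        kernelSeries q (a * q) (c * q) z) := by
  rw [kernelSeries, qBinomSeries_shift hq0 hq1 a z, qBinomSeries_shift hq0 hq1 c 1, mul_one,
    kernelSeries]
  ring

/-- The connection between the kernel polynomials of parameters `(a, c)` and `(a q, c q)`. -/
theorem kernelPoly_connection {q : ℝ} (hq0 : 0 < q) (hq1 : q < 1) (a c z : ℂ) (n : ℕ) :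
    (1 - a * (q : ℂ) ^ (n + 1)) * (1 - a) * (a * z - 1) * (z - c) * (1 - c) *
        kernelPoly q (a * q) (c * q) n z =
      a * (1 - c) * (1 - (q : ℂ) ^ (n + 1)) * (1 - (q : ℂ) ^ (n + 2)) *
          kernelPoly q a c (n + 2) z +
        (1 - a * c * (q : ℂ) ^ (n + 1)) * (c - a) * (1 - (q : ℂ) ^ (n + 1)) *
          kernelPoly q a c (n + 1) z +
        (1 - a * c * (q : ℂ) ^ n) * (1 - a * c * (q : ℂ) ^ (n + 1)) * (a - 1) * z *
          kernelPoly q a c n z := by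
  -- The factor `X^2` supplies zero values at the indices `-1` and `-2`, so the relations below need
  -- no boundary cases.
  set S := PowerSeries.X ^ 2 * kernelSeries q (a * q) (c * q) z with hS
  have hq : (q : ℂ) ≠ 0 := by exact_mod_cast hq0.ne'
  have hshift : ∀ k, PowerSeries.coeff (k + 2) S = kernelPoly q (a * q) (c * q) k z := fun k => by
    rw [hS, PowerSeries.coeff_X_pow_mul, coeff_kernelSeries]
  have hrec : ∀ k : ℕ, (1 - (q : ℂ) ^ k) * PowerSeries.coeff (k + 2) S =
      (z + 1 - (a * z + c) * (q : ℂ) ^ k) * PowerSeries.coeff (k + 1) S -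
        z * (1 - a * c * (q : ℂ) ^ k) * PowerSeries.coeff k S := by
    intro k
    have h : (1 - PowerSeries.C z * PowerSeries.X) * ((1 - PowerSeries.C 1 * PowerSeries.X) *
        (PowerSeries.C ((q : ℂ) ^ 2) * S)) =
      (1 - PowerSeries.C (a * q * z) * PowerSeries.X) *
        ((1 - PowerSeries.C (c * q) * PowerSeries.X) * PowerSeries.rescale (q : ℂ) S) := by
      have h1 := kernelSeries_rescale hq0 hq1 (a * q) (c * q) z
      have h2 : PowerSeries.rescale (q : ℂ) (PowerSeries.X ^ 2) =
          PowerSeries.C ((q : ℂ) ^ 2) * PowerSeries.X ^ 2 := by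
        ext m
        rw [PowerSeries.coeff_rescale, PowerSeries.coeff_C_mul, PowerSeries.coeff_X_pow]
        split_ifs with hm
        · rw [hm]
        · simp
      rw [hS, map_mul (PowerSeries.rescale (q : ℂ)), h2]
      linear_combination PowerSeries.C ((q : ℂ) ^ 2) * PowerSeries.X ^ 2 * h1
    have h3 := congrArg (PowerSeries.coeff (k + 2)) h
    rw [coeff_add_two_one_sub_mul, coeff_add_two_one_sub_mul] at h3
    simp only [PowerSeries.coeff_C_mul, PowerSeries.coeff_rescale] at h3
    refine mul_left_cancel₀ (pow_ne_zero 2 hq) ?_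
    linear_combination h3
  have hconn : ∀ k : ℕ, kernelPoly q a c k z = PowerSeries.coeff (k + 2) S -
      (a * z + c) * PowerSeries.coeff (k + 1) S + a * z * c * PowerSeries.coeff k S := by
    intro k
    rw [← coeff_add_two_one_sub_mul, ← coeff_kernelSeries, kernelSeries_shift hq0 hq1, hS,
      ← PowerSeries.coeff_X_pow_mul _ 2 k]
    congr 1
    ring
  rw [hconn, hconn, hconn, ← hshift]
  -- `hconn` writes the right side in terms of five consecutive coefficients of `S`; the recurrence
  -- at `n`, `n+1` and `n+2` eliminates all of them except the one of index `n+2`.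
  linear_combination -(a * (1 - c) * (1 - (q : ℂ) ^ (n + 1))) * hrec (n + 2) -
    (1 - a * c * (q : ℂ) ^ (n + 1)) * (a - 1) * a * c * z * hrec n -
    (a * c * (c - a) * (1 - (q : ℂ) ^ (n + 1)) +
      (a - 1) * (a * c * (z + 1) - (a * z + c))) * hrec (n + 1)

/-! ### Orthogonality against a bilateral sequence -/

/-- A balanced summation: if `u` solves the recurrence of a bilateral `q`-hypergeometric term,
then its convolution with the coefficients of the kernel polynomials satisfies a first order
recurrence. -/
theorem sum_qBinom_mul_recurrence {q : ℝ} (hq0 : 0 < q) (hq1 : q < 1) {a c : ℂ} {u : ℤ → ℂ}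
    (hu : ∀ k : ℤ, (1 - c * (q : ℂ) ^ k) * u (k + 1) = (a - (q : ℂ) ^ k) * u k) (n m : ℕ)
    (hmn : m ≤ n) :
    (1 - c * (q : ℂ) ^ m) * (1 - (q : ℂ) ^ (n - m)) *
        ∑ j ∈ Finset.range (n + 1), qBinom a q j * qBinom c q (n - j) * u (m + 1 - j) =
      (1 - (q : ℂ) ^ m) * (1 - a * (q : ℂ) ^ (n - m)) *
        ∑ j ∈ Finset.range (n + 1), qBinom a q j * qBinom c q (n - j) * u (m - j) := by
  have hq : (q : ℂ) ≠ 0 := by exact_mod_cast hq0.ne'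
  -- A telescoping certificate. Its factors `1 - q^j` and `1 - q^(n+1-j)` make it vanish at both
  -- ends `j = 0` and `j = n+1`.
  set G : ℕ → ℂ := fun j => -((1 - (q : ℂ) ^ j) * qBinom a q j *
    ((1 - (q : ℂ) ^ (n + 1 - j)) * qBinom c q (n + 1 - j)) * u (m + 1 - j)) with hG
  have hterm : ∀ j ∈ Finset.range (n + 1),
      (1 - c * (q : ℂ) ^ m) * (1 - (q : ℂ) ^ (n - m)) *
          (qBinom a q j * qBinom c q (n - j) * u (m + 1 - j)) -
        (1 - (q : ℂ) ^ m) * (1 - a * (q : ℂ) ^ (n - m)) *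
          (qBinom a q j * qBinom c q (n - j) * u (m - j)) = G (j + 1) - G j := by
    intro j hj
    obtain ⟨i, rfl⟩ := Nat.exists_eq_add_of_le (Nat.lt_succ_iff.mp (Finset.mem_range.mp hj))
    have e1 : j + i + 1 - j = i + 1 := by omega
    have e2 : j + i + 1 - (j + 1) = i := by omega
    have e3 : j + i - j = i := by omega
    have e4 : (m : ℤ) + 1 - ((j + 1 : ℕ) : ℤ) = m - j := by push_cast; ring
    have e5 : (m : ℤ) - j + 1 = m + 1 - j := by ring
    have hA := qBinom_succ hq0 hq1 a j
    have hB := qBinom_succ hq0 hq1 c i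
    have hU := hu (m - j)
    rw [e5, zpow_sub₀ hq, zpow_natCast, zpow_natCast] at hU
    -- The recurrence of `u` at `m - j`, multiplied by `q^j` to remove negative powers.
    have hU' : ((q : ℂ) ^ j - c * (q : ℂ) ^ m) * u (m + 1 - j) =
        (a * (q : ℂ) ^ j - (q : ℂ) ^ m) * u (m - j) := by
      have := pow_ne_zero j hq
      field_simp at hU
      linear_combination hU
    obtain ⟨l, hl⟩ := Nat.exists_eq_add_of_le hmn
    have hl' : j + i - m = l := by omega
    have hx : (q : ℂ) ^ j * (q : ℂ) ^ i = (q : ℂ) ^ m * (q : ℂ) ^ l := by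
      rw [← pow_add, ← pow_add, hl]
    simp only [hG]
    rw [e1, e2, e3, e4, hA, hB, hl']
    refine mul_left_cancel₀ (pow_ne_zero j hq) ?_
    linear_combination qBinom a q j * qBinom c q i * (((q : ℂ) ^ j - (q : ℂ) ^ l) * hU' +
      (c * (1 - (q : ℂ) ^ j) * u (m + 1 - j) + (a * (q : ℂ) ^ j - 1) * u (m - j)) * hx)
  have hsum := Finset.sum_congr rfl hterm
  rw [Finset.sum_range_sub, Finset.sum_sub_distrib, ← Finset.mul_sum, ← Finset.mul_sum] at hsum
  have h0 : G 0 = 0 := by simp [hG]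
  have h1 : G (n + 1) = 0 := by simp [hG]
  rw [h0, h1, sub_zero] at hsum
  exact sub_eq_zero.mp hsum

/-- At `m = 0` the factor `1 - q^m` on the right of the recurrence is zero, which starts the
induction; `m < n` keeps the factor `1 - q^(n-m)` on the left nonzero. -/
theorem sum_qBinom_mul_eq_zero {q : ℝ} (hq0 : 0 < q) (hq1 : q < 1) {a c : ℂ} (hc : ‖c‖ < 1)
    {u : ℤ → ℂ} (hu : ∀ k : ℤ, (1 - c * (q : ℂ) ^ k) * u (k + 1) = (a - (q : ℂ) ^ k) * u k)
    {n m : ℕ} (hmn : m < n) :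
    ∑ j ∈ Finset.range (n + 1), qBinom a q j * qBinom c q (n - j) * u (m + 1 - j) = 0 := by
  have hne : ∀ m < n, (1 - c * (q : ℂ) ^ m) * (1 - (q : ℂ) ^ (n - m)) ≠ 0 := fun m hm => by
    obtain ⟨l, hl⟩ := Nat.exists_eq_add_of_lt hm
    have : n - m = l + 1 := by omega
    rw [this]
    exact mul_ne_zero (one_sub_mul_pow_ne_zero hq0 hq1 hc m) (one_sub_pow_succ_ne_zero hq0 hq1 l)
  induction m with
  | zero =>
    have h := sum_qBinom_mul_recurrence hq0 hq1 hu n 0 hmn.le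
    rw [pow_zero, sub_self, zero_mul, zero_mul] at h
    exact (mul_eq_zero.mp h).resolve_left (by simpa using hne 0 hmn)
  | succ m ih =>
    have h := sum_qBinom_mul_recurrence hq0 hq1 hu n (m + 1) hmn.le
    have h' := ih (by omega)
    push_cast at h ⊢
    rw [h', mul_zero] at h
    exact (mul_eq_zero.mp h).resolve_left (hne _ hmn)

/-! ### The terminating series -/

theorem qPoch_inv_pow_eq_zero {q : ℝ} (hq0 : 0 < q) {n k : ℕ} (hk : n < k) :
    qPoch (((q : ℂ) ^ n)⁻¹) q k = 0 := by
  have hq : (q : ℂ) ≠ 0 := by exact_mod_cast hq0.ne'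
  refine Finset.prod_eq_zero (Finset.mem_range.mpr hk) ?_
  rw [inv_mul_cancel₀ (pow_ne_zero n hq), sub_self]

theorem qPoch_reverse {q : ℝ} (hq0 : 0 < q) (hq1 : q < 1) {c : ℂ} (hc0 : c ≠ 0) (hc : ‖c‖ < 1)
    {n k : ℕ} (hk : k ≤ n) :
    qPoch c q n * (qPoch (((q : ℂ) ^ n)⁻¹) q k / qPoch (q / (c * (q : ℂ) ^ n)) q k *
        (q / c) ^ k) = qPoch q q n * qBinom c q (n - k) := by
  have hq : (q : ℂ) ≠ 0 := by exact_mod_cast hq0.ne'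
  have hqq := qPoch_ne_zero hq0 hq1 (norm_ofReal_lt_one hq0 hq1)
  induction k with
  | zero =>
    have := hqq n
    rw [qPoch_zero, qPoch_zero, Nat.sub_zero, qBinom]
    field_simp
  | succ k ih =>
    obtain ⟨i, rfl⟩ := Nat.exists_eq_add_of_le hk
    have h := ih (by omega)
    have e1 : k + 1 + i - k = i + 1 := by omega
    have e2 : k + 1 + i - (k + 1) = i := by omega
    rw [e1] at h
    rw [e2, qPoch_succ, qPoch_succ _ _ k, pow_succ (q / c : ℂ) k]
    have hb := qBinom_succ hq0 hq1 c i
    have h1 := one_sub_mul_pow_ne_zero hq0 hq1 hc i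
    have hratio : (1 - ((q : ℂ) ^ (k + 1 + i))⁻¹ * (q : ℂ) ^ k) /
        (1 - q / (c * (q : ℂ) ^ (k + 1 + i)) * (q : ℂ) ^ k) * (q / c) =
        (1 - (q : ℂ) ^ (i + 1)) / (1 - c * (q : ℂ) ^ i) := by
      have hk0 := pow_ne_zero k hq
      have hi0 := pow_ne_zero i hq
      have h2 : 1 - q / (c * (q : ℂ) ^ (k + 1 + i)) * (q : ℂ) ^ k =
          -(1 - c * (q : ℂ) ^ i) / (c * (q : ℂ) ^ i) := by
        rw [pow_add, pow_add]
        field_simp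
        ring
      have h3 : 1 - ((q : ℂ) ^ (k + 1 + i))⁻¹ * (q : ℂ) ^ k =
          -(1 - (q : ℂ) ^ (i + 1)) / ((q : ℂ) ^ (i + 1)) := by
        rw [pow_add, pow_add, pow_add]
        field_simp
        ring
      rw [h2, h3, pow_succ]
      field_simp
    calc _ = (qPoch c q (k + 1 + i) * (qPoch (((q : ℂ) ^ (k + 1 + i))⁻¹) q k /
          qPoch (q / (c * (q : ℂ) ^ (k + 1 + i))) q k * (q / c) ^ k)) *
        ((1 - ((q : ℂ) ^ (k + 1 + i))⁻¹ * (q : ℂ) ^ k) /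
        (1 - q / (c * (q : ℂ) ^ (k + 1 + i)) * (q : ℂ) ^ k) * (q / c)) := by
          rw [mul_div_mul_comm]; ring
      _ = _ := by
        rw [h, hratio, mul_assoc, mul_div_assoc', mul_comm (qBinom c q (i + 1)), hb]
        field_simp

theorem qPoch_mul_phi21 {q : ℝ} (hq0 : 0 < q) (hq1 : q < 1) (a : ℂ) {c : ℂ} (hc0 : c ≠ 0)
    (hc : ‖c‖ < 1) (n : ℕ) (z : ℂ) :
    qPoch c q n * phi21 (((q : ℂ) ^ n)⁻¹) a (q / (c * (q : ℂ) ^ n)) q (q / c * z) =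
      qPoch q q n * kernelPoly q a c n z := by
  rw [phi21, tsum_eq_sum (s := Finset.range (n + 1)), kernelPoly, Finset.mul_sum, Finset.mul_sum]
  · refine Finset.sum_congr rfl fun k hk => ?_
    have h := qPoch_reverse hq0 hq1 hc0 hc (Nat.lt_succ_iff.mp (Finset.mem_range.mp hk))
    rw [mul_pow, qBinom, mul_div_mul_comm]
    linear_combination qPoch a q k / qPoch q q k * z ^ k * h
  · intro k hk
    -- Beyond index `n` the numerator vanishes. The denominator may vanish there too, for instance
    -- when `c = q`, and the quotient is then still `0`.
    rw [qPoch_inv_pow_eq_zero hq0 (by simpa using hk)]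
    simp

end QSeries

/-! ### Fourier coefficients with respect to arc length. -/

namespace UnitCircle

open ComplexConjugate Filter Topology

/-! ### The arc length measure -/

theorem continuous_exp_I_mul : Continuous fun θ : ℝ => Complex.exp (Complex.I * θ) := by fun_prop

theorem ae_arcMeasure_norm : ∀ᵐ ζ ∂arcMeasure, ‖ζ‖ = 1 := by
  refine Measure.ae_smul_measure ?_ _
  rw [ae_map_iff continuous_exp_I_mul.aemeasurable
    (measurableSet_eq_fun measurable_norm measurable_const)]
  refine Eventually.of_forall fun θ => ?_
  rw [mul_comm, Complex.norm_exp_ofReal_mul_I]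

instance isProbabilityMeasure_arcMeasure : IsProbabilityMeasure arcMeasure := by
  constructor
  have hπ := Real.pi_pos
  rw [arcMeasure, Measure.smul_apply, Measure.map_apply continuous_exp_I_mul.measurable
    MeasurableSet.univ, Set.preimage_univ, Measure.restrict_apply_univ, Real.volume_Ioc, sub_zero,
    smul_eq_mul, ← ENNReal.ofReal_mul (by positivity), one_div, inv_mul_cancel₀ (by positivity),
    ENNReal.ofReal_one]

theorem arcMeasure_singleton (z : ℂ) : arcMeasure {z} = 0 := by
  rw [arcMeasure, Measure.smul_apply, Measure.map_apply continuous_exp_I_mul.measurable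
    (measurableSet_singleton z)]
  have hc : ((fun θ : ℝ => Complex.exp (Complex.I * θ)) ⁻¹' {z}).Countable := by
    rcases Set.eq_empty_or_nonempty ((fun θ : ℝ => Complex.exp (Complex.I * θ)) ⁻¹' {z}) with
      h | ⟨θ₀, h₀⟩
    · rw [h]
      exact Set.countable_empty
    · refine (Set.countable_range fun n : ℤ => θ₀ + n * (2 * Real.pi)).mono fun θ hθ => ?_
      have h : Complex.exp (Complex.I * θ) = Complex.exp (Complex.I * θ₀) := by
        rw [Set.mem_preimage, Set.mem_singleton_iff] at hθ h₀
        rw [hθ, h₀]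
      obtain ⟨n, hn⟩ := Complex.exp_eq_exp_iff_exists_int.mp h
      refine ⟨n, ?_⟩
      have h2 : (θ : ℂ) = θ₀ + n * (2 * Real.pi) := by
        refine mul_left_cancel₀ Complex.I_ne_zero ?_
        rw [hn]
        ring
      simp only
      exact_mod_cast h2.symm
  rw [hc.measure_zero, smul_zero]

instance : NullSingletonClass arcMeasure := ⟨arcMeasure_singleton⟩

theorem measurable_zpow (j : ℤ) : Measurable fun ζ : ℂ => ζ ^ j := by
  cases j with
  | ofNat n => simpa using (measurable_id (α := ℂ)).pow_const n
  | negSucc n =>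
    simp only [zpow_negSucc]
    exact ((measurable_id (α := ℂ)).pow_const (n + 1)).inv

theorem integral_zpow_arcMeasure (j : ℤ) :
    ∫ ζ, ζ ^ j ∂arcMeasure = if j = 0 then 1 else 0 := by
  split_ifs with hj
  · simp [hj]
  · have hc : Complex.I * j ≠ 0 := mul_ne_zero Complex.I_ne_zero (by exact_mod_cast hj)
    rw [arcMeasure, integral_smul_measure, integral_map continuous_exp_I_mul.aemeasurable
      (measurable_zpow j).aestronglyMeasurable,
      ← intervalIntegral.integral_of_le (by positivity)]
    have h : ∀ θ : ℝ, Complex.exp (Complex.I * θ) ^ j = Complex.exp (Complex.I * j * θ) := by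
      intro θ
      rw [← Complex.exp_int_mul]
      congr 1
      ring
    simp only [h]
    rw [integral_exp_mul_complex hc]
    have h2 : Complex.exp (Complex.I * j * ((2 * Real.pi : ℝ) : ℂ)) = 1 := by
      rw [Complex.exp_eq_one_iff]
      exact ⟨j, by push_cast; ring⟩
    rw [h2]
    simp

theorem ae_norm_zpow_le (j : ℤ) : ∀ᵐ ζ ∂arcMeasure, ‖ζ ^ j‖ ≤ 1 := by
  filter_upwards [ae_arcMeasure_norm] with ζ hζ
  rw [norm_zpow, hζ, one_zpow]

theorem integrable_zpow_mul {F : ℂ → ℂ} (hF : Integrable F arcMeasure) (j : ℤ) :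
    Integrable (fun ζ => ζ ^ j * F ζ) arcMeasure :=
  hF.bdd_mul (measurable_zpow j).aestronglyMeasurable (ae_norm_zpow_le j)

/-- The Fourier coefficients `∫ ζ ^ (-k) F(ζ) dζ / (2 π i ζ)`. -/
def circleCoeff (F : ℂ → ℂ) (k : ℤ) : ℂ := ∫ ζ, ζ ^ (-k) * F ζ ∂arcMeasure

theorem circleCoeff_congr {F G : ℂ → ℂ} (h : ∀ ζ : ℂ, ‖ζ‖ = 1 → F ζ = G ζ) (k : ℤ) :
    circleCoeff F k = circleCoeff G k := by
  refine integral_congr_ae ?_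
  filter_upwards [ae_arcMeasure_norm] with ζ hζ
  rw [h ζ hζ]

theorem circleCoeff_one_sub_mul {F : ℂ → ℂ} (hF : Integrable F arcMeasure) (c : ℂ) (k : ℤ) :
    circleCoeff (fun ζ => (1 - c * ζ) * F ζ) k = circleCoeff F k - c * circleCoeff F (k - 1) := by
  unfold circleCoeff
  rw [← integral_const_mul, ← integral_sub (integrable_zpow_mul hF _)
    ((integrable_zpow_mul hF _).const_mul c)]
  refine integral_congr_ae ?_
  filter_upwards [ae_arcMeasure_norm] with ζ hζ
  have h0 : ζ ≠ 0 := norm_ne_zero_iff.mp (by rw [hζ]; exact one_ne_zero)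
  rw [show -(k - 1) = -k + 1 by ring, zpow_add₀ h0, zpow_one]
  ring

theorem circleCoeff_one_sub_mul_inv {F : ℂ → ℂ} (hF : Integrable F arcMeasure) (c : ℂ) (k : ℤ) :
    circleCoeff (fun ζ => (1 - c * ζ⁻¹) * F ζ) k =
      circleCoeff F k - c * circleCoeff F (k + 1) := by
  unfold circleCoeff
  rw [← integral_const_mul, ← integral_sub (integrable_zpow_mul hF _)
    ((integrable_zpow_mul hF _).const_mul c)]
  refine integral_congr_ae ?_
  filter_upwards [ae_arcMeasure_norm] with ζ hζ
  have h0 : ζ ≠ 0 := norm_ne_zero_iff.mp (by rw [hζ]; exact one_ne_zero)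
  rw [show -(k + 1) = -k + -1 by ring, zpow_add₀ h0, zpow_neg_one]
  ring

theorem summable_norm_mul_conj {g h : ℕ → ℂ} (hg : Summable fun n => ‖g n‖)
    (hh : Summable fun n => ‖h n‖) : Summable fun p : ℕ × ℕ => ‖g p.1 * conj (h p.2)‖ := by
  refine Summable.mul_norm (f := g) (g := fun n => conj (h n)) hg ?_
  simpa using hh

/-- The Fourier coefficients of a product `F * conj H` of absolutely convergent power series. -/
theorem circleCoeff_mul_conj {g h : ℕ → ℂ} (hg : Summable fun n => ‖g n‖)
    (hh : Summable fun n => ‖h n‖) {F H : ℂ → ℂ}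
    (hF : ∀ ζ : ℂ, ‖ζ‖ = 1 → HasSum (fun n => g n * ζ ^ n) (F ζ))
    (hH : ∀ ζ : ℂ, ‖ζ‖ = 1 → HasSum (fun n => h n * ζ ^ n) (H ζ)) (k : ℤ) :
    circleCoeff (fun ζ => F ζ * conj (H ζ)) k =
      ∑' p : ℕ × ℕ, if (p.1 : ℤ) - p.2 = k then g p.1 * conj (h p.2) else 0 := by
  have hpt : ∀ᵐ ζ ∂arcMeasure, ζ ^ (-k) * (F ζ * conj (H ζ)) =
      ∑' p : ℕ × ℕ, g p.1 * conj (h p.2) * ζ ^ ((p.1 : ℤ) - p.2 - k) := by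
    filter_upwards [ae_arcMeasure_norm] with ζ hζ
    have h0 : ζ ≠ 0 := norm_ne_zero_iff.mp (by rw [hζ]; exact one_ne_zero)
    have hH' : HasSum (fun n => conj (h n * ζ ^ n)) (conj (H ζ)) := (hH ζ hζ).map
      (starRingEnd ℂ) Complex.continuous_conj
    rw [← (hF ζ hζ).tsum_eq, ← hH'.tsum_eq, tsum_mul_tsum_of_summable_norm, ← tsum_mul_left]
    · refine tsum_congr fun p => ?_
      have hc : conj ζ = ζ⁻¹ := by rw [Complex.inv_eq_conj hζ]
      rw [map_mul, map_pow, hc, zpow_sub₀ h0, zpow_sub₀ h0, zpow_neg, zpow_natCast, zpow_natCast,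
        inv_pow]
      field_simp
    · simpa [hζ] using hg
    · simpa [hζ] using hh
  have hint : ∀ p : ℕ × ℕ, Integrable
      (fun ζ : ℂ => g p.1 * conj (h p.2) * ζ ^ ((p.1 : ℤ) - p.2 - k)) arcMeasure := fun p => by
    have := (integrable_zpow_mul (integrable_const (1 : ℂ)) ((p.1 : ℤ) - p.2 - k)).const_mul
      (g p.1 * conj (h p.2))
    simpa using this
  have hnorm : ∀ p : ℕ × ℕ,
      ∫ ζ : ℂ, ‖g p.1 * conj (h p.2) * ζ ^ ((p.1 : ℤ) - p.2 - k)‖ ∂arcMeasure =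
        ‖g p.1 * conj (h p.2)‖ := fun p => by
    have : ∀ᵐ ζ ∂arcMeasure, ‖g p.1 * conj (h p.2) * ζ ^ ((p.1 : ℤ) - p.2 - k)‖ =
        ‖g p.1 * conj (h p.2)‖ := by
      filter_upwards [ae_arcMeasure_norm] with ζ hζ
      rw [norm_mul, norm_zpow, hζ, one_zpow, mul_one]
    rw [integral_congr_ae this]
    simp
  rw [circleCoeff, integral_congr_ae hpt, ← (hasSum_integral_of_summable_integral_norm hint
    (by simpa only [hnorm] using summable_norm_mul_conj hg hh)).tsum_eq]
  refine tsum_congr fun p => ?_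
  rw [integral_const_mul, integral_zpow_arcMeasure]
  simp only [sub_eq_zero, mul_ite, mul_one, mul_zero]

/-- In the double series for the `n`-th coefficient each fixed term disappears once `n` exceeds its
first index; dominated convergence does the rest. -/
theorem tendsto_circleCoeff_mul_conj {g h : ℕ → ℂ} (hg : Summable fun n => ‖g n‖)
    (hh : Summable fun n => ‖h n‖) {F H : ℂ → ℂ}
    (hF : ∀ ζ : ℂ, ‖ζ‖ = 1 → HasSum (fun n => g n * ζ ^ n) (F ζ))
    (hH : ∀ ζ : ℂ, ‖ζ‖ = 1 → HasSum (fun n => h n * ζ ^ n) (H ζ)) :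
    Tendsto (fun n : ℕ => circleCoeff (fun ζ => F ζ * conj (H ζ)) n) atTop (𝓝 0) := by
  simp only [circleCoeff_mul_conj hg hh hF hH]
  have h0 : (0 : ℂ) = ∑' _ : ℕ × ℕ, (0 : ℂ) := tsum_zero.symm
  rw [show 𝓝 (0 : ℂ) = 𝓝 (∑' _ : ℕ × ℕ, (0 : ℂ)) from congrArg 𝓝 h0]
  refine tendsto_tsum_of_dominated_convergence (summable_norm_mul_conj hg hh) (fun p => ?_)
    (Eventually.of_forall fun n p => ?_)
  · refine tendsto_const_nhds.congr' ?_
    filter_upwards [eventually_gt_atTop p.1] with n hn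
    rw [if_neg (by omega)]
  · split_ifs
    · exact le_rfl
    · rw [norm_zero]
      exact norm_nonneg _

end UnitCircle

/-! ### Analysis of the quotient `(qz;q)_∞/(az;q)_∞`. -/

namespace QSeries

open ComplexConjugate Filter Topology

/-! ### Infinite `q`-shifted factorials -/

section

variable {q : ℝ}

theorem summable_norm_neg_mul_pow (hq0 : 0 < q) (hq1 : q < 1) (a : ℂ) :
    Summable fun j : ℕ => ‖-(a * (q : ℂ) ^ j)‖ := by
  simp only [norm_neg, norm_mul, norm_pow]
  exact (summable_geometric_of_lt_one (norm_nonneg _) (norm_ofReal_lt_one hq0 hq1)).mul_left _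

theorem tendsto_qPoch (hq0 : 0 < q) (hq1 : q < 1) (a : ℂ) :
    Tendsto (qPoch a q) atTop (𝓝 (qPochInf a q)) := by
  have h := multipliable_one_add_of_summable (summable_norm_neg_mul_pow hq0 hq1 a)
  simp only [← sub_eq_add_neg] at h
  exact h.hasProd.tendsto_prod_nat

theorem qPochInf_ne_zero (hq0 : 0 < q) (hq1 : q < 1) {a : ℂ} (ha : ‖a‖ < 1) :
    qPochInf a q ≠ 0 := by
  have h := tprod_one_add_ne_zero_of_summable (f := fun j : ℕ => -(a * (q : ℂ) ^ j))
    (fun j => by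
      rw [← sub_eq_add_neg]
      exact one_sub_mul_pow_ne_zero hq0 hq1 ha j)
    (summable_norm_neg_mul_pow hq0 hq1 a)
  simp only [← sub_eq_add_neg] at h
  exact h

theorem qPochInf_eq_mul (hq0 : 0 < q) (hq1 : q < 1) (a : ℂ) :
    qPochInf a q = (1 - a) * qPochInf (a * q) q := by
  refine tendsto_nhds_unique ((tendsto_qPoch hq0 hq1 a).comp (tendsto_add_atTop_nat 1)) ?_
  refine ((tendsto_qPoch hq0 hq1 (a * q)).const_mul (1 - a)).congr fun n => ?_
  rw [Function.comp_apply, qPoch_succ']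

theorem qPochInf_eq_qPoch_mul (hq0 : 0 < q) (hq1 : q < 1) (a : ℂ) (n : ℕ) :
    qPochInf a q = qPoch a q n * qPochInf (a * (q : ℂ) ^ n) q := by
  induction n with
  | zero => simp [qPoch_zero]
  | succ n ih => rw [ih, qPochInf_eq_mul hq0 hq1 (a * (q : ℂ) ^ n), qPoch_succ, pow_succ]; ring_nf

theorem norm_qPoch_le (hq0 : 0 < q) (hq1 : q < 1) {a : ℂ} (ha : ‖a‖ ≤ 1) (n : ℕ) :
    ‖qPoch a q n‖ ≤ Real.exp (∑' j : ℕ, q ^ j) := by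
  have hs := summable_geometric_of_lt_one hq0.le hq1
  calc ‖qPoch a q n‖ ≤ ∏ j ∈ Finset.range n, Real.exp (q ^ j) := by
        rw [qPoch, norm_prod]
        refine Finset.prod_le_prod (fun _ _ => norm_nonneg _) fun j _ => ?_
        have h1 : ‖a * (q : ℂ) ^ j‖ ≤ q ^ j := by
          rw [norm_mul, norm_pow, Complex.norm_real, Real.norm_of_nonneg hq0.le]
          exact mul_le_of_le_one_left (pow_nonneg hq0.le j) ha
        have h2 := norm_sub_le (1 : ℂ) (a * (q : ℂ) ^ j)
        rw [norm_one] at h2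
        linarith [Real.add_one_le_exp (q ^ j)]
    _ = Real.exp (∑ j ∈ Finset.range n, q ^ j) := (Real.exp_sum _ _).symm
    _ ≤ _ := Real.exp_le_exp.mpr (hs.sum_le_tsum _ fun j _ => pow_nonneg hq0.le j)

theorem measurable_qPochInf (hq0 : 0 < q) (hq1 : q < 1) (c : ℂ) :
    Measurable fun ζ : ℂ => qPochInf (c * ζ) q := by
  refine measurable_of_tendsto_metrizable (f := fun n (ζ : ℂ) => qPoch (c * ζ) q n) (fun n => ?_)
    (tendsto_pi_nhds.mpr fun ζ => tendsto_qPoch hq0 hq1 (c * ζ))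
  unfold qPoch
  exact (continuous_finsetProd _ fun j _ => by fun_prop).measurable

/-! ### The `q`-binomial theorem -/

/-- The quotient `(q z; q)_∞ / (a z; q)_∞`. -/
def binomFun (q : ℝ) (a z : ℂ) : ℂ := qPochInf (q * z) q / qPochInf (a * z) q

/-- The Taylor coefficients of `binomFun`. -/
def binomCoeff (q : ℝ) (a : ℂ) (n : ℕ) : ℂ :=
  ∏ j ∈ Finset.range n, (a - (q : ℂ) ^ (j + 1)) / (1 - (q : ℂ) ^ (j + 1))

theorem binomCoeff_succ (hq0 : 0 < q) (hq1 : q < 1) (a : ℂ) (n : ℕ) :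
    (1 - (q : ℂ) ^ (n + 1)) * binomCoeff q a (n + 1) =
      (a - (q : ℂ) ^ (n + 1)) * binomCoeff q a n := by
  have := one_sub_pow_succ_ne_zero hq0 hq1 n
  rw [binomCoeff, Finset.prod_range_succ, ← binomCoeff]
  field_simp

/-- The ratio of consecutive terms tends to `a` in norm. The case `c = 1` serves the `q`-binomial
series and `c = conj a` the series for the total mass. -/
theorem summable_norm_of_recurrence (hq0 : 0 < q) (hq1 : q < 1) {a c : ℂ} (ha : ‖a‖ < 1)
    {x : ℕ → ℂ} (hx : ∀ n, (1 - c * (q : ℂ) ^ (n + 1)) * x (n + 1) =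
      (a - (q : ℂ) ^ (n + 1)) * x n) : Summable fun n => ‖x n‖ := by
  obtain ⟨r, hr, hr1⟩ := exists_between ha
  have hpow : Tendsto (fun n : ℕ => (q : ℂ) ^ (n + 1)) atTop (𝓝 0) :=
    (tendsto_pow_atTop_nhds_zero_of_norm_lt_one (norm_ofReal_lt_one hq0 hq1)).comp
      (tendsto_add_atTop_nat 1)
  have h1 : Tendsto (fun n : ℕ => r * ‖1 - c * (q : ℂ) ^ (n + 1)‖) atTop (𝓝 r) := by
    simpa using (((hpow.const_mul c).const_sub 1).norm).const_mul r
  have h2 : Tendsto (fun n : ℕ => ‖a - (q : ℂ) ^ (n + 1)‖) atTop (𝓝 ‖a‖) := by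
    simpa using (hpow.const_sub a).norm
  have h3 : ∀ᶠ n : ℕ in atTop, 0 < ‖1 - c * (q : ℂ) ^ (n + 1)‖ := by
    have : Tendsto (fun n : ℕ => ‖1 - c * (q : ℂ) ^ (n + 1)‖) atTop (𝓝 1) := by
      simpa using ((hpow.const_mul c).const_sub 1).norm
    exact this.eventually (lt_mem_nhds one_pos)
  refine summable_of_ratio_norm_eventually_le hr1 ?_
  filter_upwards [h2.eventually_lt h1 hr, h3] with n hn hn'
  rw [norm_norm, norm_norm]
  have h4 := congrArg norm (hx n)
  rw [norm_mul, norm_mul] at h4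
  refine le_of_mul_le_mul_left ?_ hn'
  rw [h4]
  nlinarith [norm_nonneg (x n)]

theorem summable_norm_binomCoeff (hq0 : 0 < q) (hq1 : q < 1) {a : ℂ} (ha : ‖a‖ < 1) :
    Summable fun n => ‖binomCoeff q a n‖ :=
  summable_norm_of_recurrence (c := 1) hq0 hq1 ha fun n => by
    rw [one_mul]
    exact binomCoeff_succ hq0 hq1 a n

theorem summable_binomCoeff_mul_pow (hq0 : 0 < q) (hq1 : q < 1) {a z : ℂ} (ha : ‖a‖ < 1)
    (hz : ‖z‖ ≤ 1) : Summable fun n => binomCoeff q a n * z ^ n := by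
  refine Summable.of_norm_bounded (summable_norm_binomCoeff hq0 hq1 ha) fun n => ?_
  rw [norm_mul, norm_pow]
  exact mul_le_of_le_one_right (norm_nonneg _) (pow_le_one₀ (norm_nonneg _) hz)

theorem norm_mul_ofReal_le (hq0 : 0 < q) (hq1 : q < 1) {z : ℂ} (hz : ‖z‖ ≤ 1) :
    ‖z * q‖ ≤ 1 := by
  rw [norm_mul]
  exact mul_le_one₀ hz (norm_nonneg _) (norm_ofReal_lt_one hq0 hq1).le

theorem tsum_binomCoeff_qDiff (hq0 : 0 < q) (hq1 : q < 1) {a z : ℂ} (ha : ‖a‖ < 1)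
    (hz : ‖z‖ ≤ 1) :
    (1 - a * z) * ∑' n, binomCoeff q a n * z ^ n =
      (1 - q * z) * ∑' n, binomCoeff q a n * (z * q) ^ n := by
  have h1 := summable_binomCoeff_mul_pow hq0 hq1 ha hz
  have h2 := summable_binomCoeff_mul_pow hq0 hq1 ha (norm_mul_ofReal_le hq0 hq1 hz)
  have e1 := h1.tsum_eq_zero_add
  have e2 := h2.tsum_eq_zero_add
  have h1' := (summable_nat_add_iff 1).mpr h1
  have h2' := (summable_nat_add_iff 1).mpr h2
  have key : ∑' n, binomCoeff q a (n + 1) * z ^ (n + 1) -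
      a * z * ∑' n, binomCoeff q a n * z ^ n =
      ∑' n, binomCoeff q a (n + 1) * (z * q) ^ (n + 1) -
        q * z * ∑' n, binomCoeff q a n * (z * q) ^ n := by
    rw [← tsum_mul_left, ← tsum_mul_left, ← h1'.tsum_sub (h1.mul_left _),
      ← h2'.tsum_sub (h2.mul_left _)]
    refine tsum_congr fun n => ?_
    rw [mul_pow, mul_pow]
    linear_combination z ^ (n + 1) * binomCoeff_succ hq0 hq1 a n
  simp only [pow_zero] at e1 e2
  linear_combination key + e1 - e2

/-- Iterate the `q`-difference equation `N` times: the prefactors become the infinite products, and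
the series at `z q^N` tends to its constant term `1`. Since `|a| < 1`, the expansion holds on the
closed disc, hence on the circle. -/
theorem hasSum_binomFun (hq0 : 0 < q) (hq1 : q < 1) {a z : ℂ} (ha : ‖a‖ < 1) (hz : ‖z‖ ≤ 1) :
    HasSum (fun n => binomCoeff q a n * z ^ n) (binomFun q a z) := by
  have haz : ‖a * z‖ < 1 := by
    rw [norm_mul]
    exact (mul_le_of_le_one_right (norm_nonneg _) hz).trans_lt ha
  have hne := qPochInf_ne_zero hq0 hq1 haz
  have hiter : ∀ N : ℕ, qPoch (a * z) q N * ∑' n, binomCoeff q a n * z ^ n =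
      qPoch (q * z) q N * ∑' n, binomCoeff q a n * (z * (q : ℂ) ^ N) ^ n := by
    intro N
    induction N with
    | zero => simp [qPoch_zero]
    | succ N ih =>
      have hz' : ‖z * (q : ℂ) ^ N‖ ≤ 1 := by
        rw [norm_mul, norm_pow]
        exact mul_le_one₀ hz (by positivity)
          (pow_le_one₀ (norm_nonneg _) (norm_ofReal_lt_one hq0 hq1).le)
      have h := tsum_binomCoeff_qDiff hq0 hq1 ha hz'
      rw [mul_assoc z, ← pow_succ] at h
      rw [qPoch_succ, qPoch_succ]
      linear_combination (1 - a * z * (q : ℂ) ^ N) * ih + qPoch (q * z) q N * h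
  have hlim : Tendsto (fun N : ℕ => ∑' n, binomCoeff q a n * (z * (q : ℂ) ^ N) ^ n) atTop
      (𝓝 (∑' n : ℕ, if n = 0 then 1 else 0)) := by
    refine tendsto_tsum_of_dominated_convergence (summable_norm_binomCoeff hq0 hq1 ha)
      (fun n => ?_) (Eventually.of_forall fun N n => ?_)
    · rcases n with _ | n
      · simp [binomCoeff]
      · have hp : Tendsto (fun N : ℕ => z * (q : ℂ) ^ N) atTop (𝓝 0) := by
          simpa using (tendsto_pow_atTop_nhds_zero_of_norm_lt_one
            (norm_ofReal_lt_one hq0 hq1)).const_mul z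
        simpa using (hp.pow (n + 1)).const_mul (binomCoeff q a (n + 1))
    · rw [norm_mul, norm_pow, norm_mul, norm_pow]
      refine mul_le_of_le_one_right (norm_nonneg _) (pow_le_one₀ (by positivity) ?_)
      exact mul_le_one₀ hz (by positivity)
        (pow_le_one₀ (norm_nonneg _) (norm_ofReal_lt_one hq0 hq1).le)
  rw [tsum_ite_eq] at hlim
  have h := tendsto_nhds_unique
    (((tendsto_qPoch hq0 hq1 (a * z)).mul_const (∑' n, binomCoeff q a n * z ^ n)).congr hiter)
    ((tendsto_qPoch hq0 hq1 (q * z)).mul hlim)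
  have h2 : binomFun q a z = ∑' n, binomCoeff q a n * z ^ n := by
    rw [binomFun, div_eq_iff hne]
    linear_combination -h
  rw [h2]
  exact (summable_binomCoeff_mul_pow hq0 hq1 ha hz).hasSum

theorem binomFun_qDiff (hq0 : 0 < q) (hq1 : q < 1) {a z : ℂ} (ha : ‖a‖ < 1) (hz : ‖z‖ ≤ 1) :
    (1 - a * z) * binomFun q a z = (1 - q * z) * binomFun q a (z * q) := by
  rw [← (hasSum_binomFun hq0 hq1 ha hz).tsum_eq,
    ← (hasSum_binomFun hq0 hq1 ha (norm_mul_ofReal_le hq0 hq1 hz)).tsum_eq]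
  exact tsum_binomCoeff_qDiff hq0 hq1 ha hz

theorem norm_binomFun_le (hq0 : 0 < q) (hq1 : q < 1) {a z : ℂ} (ha : ‖a‖ < 1) (hz : ‖z‖ ≤ 1) :
    ‖binomFun q a z‖ ≤ ∑' n, ‖binomCoeff q a n‖ := by
  refine (hasSum_binomFun hq0 hq1 ha hz).norm_le_of_bounded
    (summable_norm_binomCoeff hq0 hq1 ha).hasSum fun n => ?_
  rw [norm_mul, norm_pow]
  exact mul_le_of_le_one_right (norm_nonneg _) (pow_le_one₀ (norm_nonneg _) hz)

theorem measurable_binomFun (hq0 : 0 < q) (hq1 : q < 1) (a : ℂ) : Measurable (binomFun q a) :=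
  (measurable_qPochInf hq0 hq1 q).div (measurable_qPochInf hq0 hq1 a)

theorem binomFun_ne_zero (hq0 : 0 < q) (hq1 : q < 1) {a z : ℂ} (ha : ‖a‖ < 1) (hz : ‖z‖ ≤ 1) :
    binomFun q a z ≠ 0 := by
  refine div_ne_zero (qPochInf_ne_zero hq0 hq1 ?_) (qPochInf_ne_zero hq0 hq1 ?_)
  · rw [mul_comm, norm_mul]
    exact (mul_le_of_le_one_left (norm_nonneg _) hz).trans_lt (norm_ofReal_lt_one hq0 hq1)
  · rw [mul_comm, norm_mul]
    exact (mul_le_of_le_one_left (norm_nonneg _) hz).trans_lt ha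

theorem binomFun_shift (hq0 : 0 < q) (hq1 : q < 1) {a z : ℂ} (ha : ‖a‖ < 1) (hz : ‖z‖ ≤ 1)
    (n : ℕ) : binomFun q (a * (q : ℂ) ^ n) z = qPoch (a * z) q n * binomFun q a z := by
  have haz : ‖a * z‖ < 1 := by
    rw [norm_mul]
    exact (mul_le_of_le_one_right (norm_nonneg _) hz).trans_lt ha
  have h1 := qPochInf_ne_zero hq0 hq1 haz
  have h2 := qPochInf_eq_qPoch_mul hq0 hq1 (a * z) n
  rw [binomFun, binomFun, show a * (q : ℂ) ^ n * z = a * z * (q : ℂ) ^ n by ring]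
  rw [h2] at h1
  have h3 := left_ne_zero_of_mul h1
  have h4 := right_ne_zero_of_mul h1
  rw [h2, div_eq_iff h4, ← mul_div_assoc, div_mul_eq_mul_div, eq_div_iff (mul_ne_zero h3 h4)]
  ring

theorem binomFun_self (hq0 : 0 < q) (hq1 : q < 1) {z : ℂ} (hz : ‖z‖ ≤ 1) :
    binomFun q q z = 1 := by
  refine div_self (qPochInf_ne_zero hq0 hq1 ?_)
  rw [mul_comm, norm_mul]
  exact (mul_le_of_le_one_left (norm_nonneg _) hz).trans_lt (norm_ofReal_lt_one hq0 hq1)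

end

end QSeries

/-! ### The weight: recurrence, Ramanujan constant and total mass. -/

namespace QSeries

open ComplexConjugate Filter Topology UnitCircle

/-! ### Fourier coefficients of the weight -/

/-- The weight `|(q ζ; q)_∞|² / |(a ζ; q)_∞|²`, as a complex valued function. -/
def weight (q : ℝ) (a ζ : ℂ) : ℂ := binomFun q a ζ * conj (binomFun q a ζ)

/-- The differences of consecutive Fourier coefficients of the weight. -/
def weightDiff (q : ℝ) (a : ℂ) (k : ℤ) : ℂ :=
  circleCoeff (weight q a) k - circleCoeff (weight q a) (k - 1)

section

variable {q : ℝ}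

theorem integrable_binomFun_mul_conj (hq0 : 0 < q) (hq1 : q < 1) {a : ℂ} (ha : ‖a‖ < 1) {c d : ℂ}
    (hc : ‖c‖ ≤ 1) (hd : ‖d‖ ≤ 1) :
    Integrable (fun ζ => binomFun q a (ζ * c) * conj (binomFun q a (ζ * d))) arcMeasure := by
  have hm := measurable_binomFun hq0 hq1 a
  refine Integrable.of_bound ?_ ((∑' n, ‖binomCoeff q a n‖) * ∑' n, ‖binomCoeff q a n‖) ?_
  · exact ((hm.comp (measurable_id.mul_const c)).mul (Complex.continuous_conj.measurable.comp
      (hm.comp (measurable_id.mul_const d)))).aestronglyMeasurable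
  · filter_upwards [ae_arcMeasure_norm] with ζ hζ
    have h1 : ∀ e : ℂ, ‖e‖ ≤ 1 → ‖ζ * e‖ ≤ 1 := fun e he => by rwa [norm_mul, hζ, one_mul]
    rw [norm_mul, RCLike.norm_conj]
    exact mul_le_mul (norm_binomFun_le hq0 hq1 ha (h1 c hc))
      (norm_binomFun_le hq0 hq1 ha (h1 d hd)) (norm_nonneg _)
      (tsum_nonneg fun _ => norm_nonneg _)

theorem integrable_weight (hq0 : 0 < q) (hq1 : q < 1) {a : ℂ} (ha : ‖a‖ < 1) :
    Integrable (weight q a) arcMeasure := by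
  have h := integrable_binomFun_mul_conj hq0 hq1 ha (c := 1) (d := 1) (by simp) (by simp)
  simp only [mul_one] at h
  exact h

theorem tendsto_circleCoeff_weight (hq0 : 0 < q) (hq1 : q < 1) {a : ℂ} (ha : ‖a‖ < 1) :
    Tendsto (fun n : ℕ => circleCoeff (weight q a) n) atTop (𝓝 0) :=
  tendsto_circleCoeff_mul_conj (summable_norm_binomCoeff hq0 hq1 ha)
    (summable_norm_binomCoeff hq0 hq1 ha) (fun _ hζ => hasSum_binomFun hq0 hq1 ha hζ.le)
    (fun _ hζ => hasSum_binomFun hq0 hq1 ha hζ.le)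

/-- In the double series a term contributes to the `k`-th coefficient only if its indices differ by
`k`, so moving the dilation by `q` from one factor to the other costs `q^k`. -/
theorem circleCoeff_binomFun_swap (hq0 : 0 < q) (hq1 : q < 1) {a : ℂ} (ha : ‖a‖ < 1) (k : ℤ) :
    circleCoeff (fun ζ => binomFun q a (ζ * q) * conj (binomFun q a ζ)) k =
      (q : ℂ) ^ k * circleCoeff (fun ζ => binomFun q a ζ * conj (binomFun q a (ζ * q))) k := by
  have hq : (q : ℂ) ≠ 0 := by exact_mod_cast hq0.ne'
  have hs := summable_norm_binomCoeff hq0 hq1 ha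
  have hs' : Summable fun n => ‖binomCoeff q a n * (q : ℂ) ^ n‖ := by
    refine hs.of_nonneg_of_le (fun n => norm_nonneg _) fun n => ?_
    rw [norm_mul, norm_pow]
    exact mul_le_of_le_one_right (norm_nonneg _)
      (pow_le_one₀ (norm_nonneg _) (norm_ofReal_lt_one hq0 hq1).le)
  have h1 : ∀ ζ : ℂ, ‖ζ‖ = 1 → HasSum (fun n => binomCoeff q a n * ζ ^ n) (binomFun q a ζ) :=
    fun _ hζ => hasSum_binomFun hq0 hq1 ha hζ.le
  have h2 : ∀ ζ : ℂ, ‖ζ‖ = 1 → HasSum (fun n => binomCoeff q a n * (q : ℂ) ^ n * ζ ^ n)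
      (binomFun q a (ζ * q)) := fun ζ hζ => by
    have h := hasSum_binomFun hq0 hq1 ha (norm_mul_ofReal_le hq0 hq1 hζ.le)
    simpa only [mul_pow, mul_comm (ζ ^ _) _, mul_assoc] using h
  rw [circleCoeff_mul_conj hs' hs h2 h1, circleCoeff_mul_conj hs hs' h1 h2, ← tsum_mul_left]
  refine tsum_congr fun p => ?_
  split_ifs with hp
  · rw [← hp, zpow_sub₀ hq, zpow_natCast, zpow_natCast, map_mul, map_pow, Complex.conj_ofReal]
    have := pow_ne_zero p.2 hq
    field_simp
  · rw [mul_zero]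

theorem weightDiff_recurrence (hq0 : 0 < q) (hq1 : q < 1) {a : ℂ} (ha : ‖a‖ < 1) (k : ℤ) :
    (1 - conj a * (q : ℂ) ^ k) * weightDiff q a (k + 1) =
      (a - (q : ℂ) ^ k) * weightDiff q a k := by
  have hq : (q : ℂ) ≠ 0 := by exact_mod_cast hq0.ne'
  have hqn := (norm_ofReal_lt_one hq0 hq1).le
  -- Both functional equations, for `F` and for `conj F`, are expressed through these auxiliary
  -- coefficients of `F(ζ) conj F(qζ)`; the final combination eliminates them.
  set s := circleCoeff (fun ζ => binomFun q a ζ * conj (binomFun q a (ζ * q)))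
  have hI := integrable_weight hq0 hq1 ha
  have hI1 := integrable_binomFun_mul_conj hq0 hq1 ha (c := 1) (d := q) (by simp) hqn
  have hI2 := integrable_binomFun_mul_conj hq0 hq1 ha (c := q) (d := 1) hqn (by simp)
  simp only [mul_one] at hI1 hI2
  have h1 : ∀ k, circleCoeff (weight q a) k - conj a * circleCoeff (weight q a) (k + 1) =
      s k - q * s (k + 1) := fun k => by
    rw [← circleCoeff_one_sub_mul_inv hI, ← circleCoeff_one_sub_mul_inv hI1]
    refine circleCoeff_congr (fun ζ hζ => ?_) k
    have h := congrArg conj (binomFun_qDiff hq0 hq1 ha hζ.le)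
    simp only [map_mul, map_sub, map_one, Complex.conj_ofReal] at h
    rw [Complex.inv_eq_conj hζ, weight]
    linear_combination binomFun q a ζ * h
  have h2 : ∀ k, circleCoeff (weight q a) k - a * circleCoeff (weight q a) (k - 1) =
      (q : ℂ) ^ k * (s k - s (k - 1)) := fun k => by
    have h3 : (q : ℂ) ^ k * (s k - s (k - 1)) = (q : ℂ) ^ k * s k -
        q * ((q : ℂ) ^ (k - 1) * s (k - 1)) := by
      rw [zpow_sub_one₀ hq]
      field_simp
    rw [h3, ← circleCoeff_binomFun_swap hq0 hq1 ha, ← circleCoeff_binomFun_swap hq0 hq1 ha,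
      ← circleCoeff_one_sub_mul hI, ← circleCoeff_one_sub_mul hI2]
    refine circleCoeff_congr (fun ζ hζ => ?_) k
    rw [weight]
    linear_combination conj (binomFun q a ζ) * binomFun_qDiff hq0 hq1 ha hζ.le
  have e1 := h1 k
  have e2 := h1 (k - 1)
  have e3 := h2 (k + 1)
  have e4 := h2 k
  rw [sub_add_cancel] at e2
  rw [add_sub_cancel_right, zpow_add_one₀ hq] at e3
  rw [weightDiff, weightDiff, add_sub_cancel_right]
  linear_combination (q : ℂ) ^ k * (e1 - e2) + e3 - e4

theorem circleCoeff_weight_shift (hq0 : 0 < q) (hq1 : q < 1) {a : ℂ} (ha : ‖a‖ < 1) (k : ℤ) :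
    circleCoeff (weight q (a * q)) k = (1 + a * conj a) * circleCoeff (weight q a) k -
      a * circleCoeff (weight q a) (k - 1) - conj a * circleCoeff (weight q a) (k + 1) := by
  have hI := integrable_weight hq0 hq1 ha
  have hI' : Integrable (fun ζ => (1 - conj a * ζ⁻¹) * weight q a ζ) arcMeasure := by
    have := hI.sub ((integrable_zpow_mul hI (-1)).const_mul (conj a))
    refine this.congr (Eventually.of_forall fun ζ => ?_)
    simp only [Pi.sub_apply, zpow_neg_one]
    ring
  have h : circleCoeff (weight q (a * q)) k =
      circleCoeff (fun ζ => (1 - a * ζ) * ((1 - conj a * ζ⁻¹) * weight q a ζ)) k := by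
    refine circleCoeff_congr (fun ζ hζ => ?_) k
    have h := binomFun_shift hq0 hq1 ha hζ.le 1
    rw [pow_one, qPoch_succ, qPoch_zero, pow_zero, one_mul, mul_one] at h
    rw [weight, weight, h, Complex.inv_eq_conj hζ]
    simp only [map_mul, map_sub, map_one]
    ring
  rw [h, circleCoeff_one_sub_mul hI', circleCoeff_one_sub_mul_inv hI,
    circleCoeff_one_sub_mul_inv hI, sub_add_cancel]
  ring

theorem norm_mul_pow_lt_one (hq0 : 0 < q) (hq1 : q < 1) {a : ℂ} (ha : ‖a‖ < 1) (n : ℕ) :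
    ‖a * (q : ℂ) ^ n‖ < 1 := by
  rw [norm_mul, norm_pow]
  exact (mul_le_of_le_one_right (norm_nonneg _)
    (pow_le_one₀ (norm_nonneg _) (norm_ofReal_lt_one hq0 hq1).le)).trans_lt ha

/-- Replacing `a` by `aq` multiplies the weight by `|1 - aζ|²`, so the new difference at `0`
involves the old ones at `-1`, `0`, `1`; the recurrence reduces these to the one at `0`. -/
theorem weightDiff_zero_shift (hq0 : 0 < q) (hq1 : q < 1) {a : ℂ} (ha : ‖a‖ < 1) :
    (1 - conj a) * (1 - a * q) * weightDiff q (a * q) 0 =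
      (1 - a * conj a) * (1 - a * conj a * q) * weightDiff q a 0 := by
  have hq : (q : ℂ) ≠ 0 := by exact_mod_cast hq0.ne'
  have h1 := weightDiff_recurrence hq0 hq1 ha 0
  have h2 := weightDiff_recurrence hq0 hq1 ha (-1)
  have h3 : weightDiff q (a * q) 0 = (1 + a * conj a) * weightDiff q a 0 -
      a * weightDiff q a (-1) - conj a * weightDiff q a 1 := by
    simp only [weightDiff]
    rw [circleCoeff_weight_shift hq0 hq1 ha, circleCoeff_weight_shift hq0 hq1 ha]
    norm_num
    ring
  rw [zpow_zero, mul_one, zero_add] at h1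
  rw [zpow_neg_one, neg_add_cancel] at h2
  have h2' : (q - conj a) * weightDiff q a 0 = (a * q - 1) * weightDiff q a (-1) := by
    field_simp at h2
    linear_combination h2
  rw [h3]
  linear_combination -(conj a * (1 - a * q)) * h1 - a * (1 - conj a) * h2'

theorem weightDiff_zero_shift_pow (hq0 : 0 < q) (hq1 : q < 1) {a : ℂ} (ha : ‖a‖ < 1) (n : ℕ) :
    qPoch (conj a) q n * qPoch (a * q) q n * weightDiff q (a * (q : ℂ) ^ n) 0 =
      qPoch (a * conj a) q (2 * n) * weightDiff q a 0 := by
  induction n with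
  | zero => simp [qPoch_zero]
  | succ n ih =>
    have h := weightDiff_zero_shift hq0 hq1 (norm_mul_pow_lt_one hq0 hq1 ha n)
    simp only [map_mul, map_pow, Complex.conj_ofReal] at h
    rw [mul_assoc a _ (q : ℂ), ← pow_succ] at h
    rw [qPoch_succ, qPoch_succ, show 2 * (n + 1) = 2 * n + 1 + 1 by ring, qPoch_succ, qPoch_succ,
      show (q : ℂ) ^ (2 * n + 1) = (q : ℂ) ^ n * (q : ℂ) ^ n * q by ring,
      show (q : ℂ) ^ (2 * n) = (q : ℂ) ^ n * (q : ℂ) ^ n by ring]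
    linear_combination qPoch (conj a) q n * qPoch (a * q) q n * h +
      (1 - a * (q : ℂ) ^ n * (conj a * (q : ℂ) ^ n)) *
        (1 - a * (q : ℂ) ^ n * (conj a * (q : ℂ) ^ n) * q) * ih

/-- The limit of the weights of parameters `a q ^ n` as `n → ∞`. -/
def limitWeight (q : ℝ) (ζ : ℂ) : ℂ := qPochInf (q * ζ) q * conj (qPochInf (q * ζ) q)

theorem tendsto_circleCoeff_limitWeight (hq0 : 0 < q) (hq1 : q < 1) {a : ℂ} (ha : ‖a‖ < 1)
    (k : ℤ) : Tendsto (fun n : ℕ => circleCoeff (weight q (a * (q : ℂ) ^ n)) k) atTop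
      (𝓝 (circleCoeff (limitWeight q) k)) := by
  set M := (Real.exp (∑' j : ℕ, q ^ j) * ∑' n, ‖binomCoeff q a n‖) ^ 2 with hM
  unfold circleCoeff
  refine tendsto_integral_of_dominated_convergence (fun _ => M) (fun n => ?_)
    (integrable_const _) (fun n => ?_) ?_
  · exact (integrable_zpow_mul (integrable_weight hq0 hq1
      (norm_mul_pow_lt_one hq0 hq1 ha n)) (-k)).aestronglyMeasurable
  · filter_upwards [ae_arcMeasure_norm] with ζ hζ
    have haz : ‖a * ζ‖ ≤ 1 := by rw [norm_mul, hζ, mul_one]; exact ha.le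
    rw [norm_mul, norm_zpow, hζ, one_zpow, one_mul, weight, norm_mul, RCLike.norm_conj, ← sq,
      binomFun_shift hq0 hq1 ha hζ.le, norm_mul, hM]
    gcongr
    · exact norm_qPoch_le hq0 hq1 haz n
    · exact norm_binomFun_le hq0 hq1 ha hζ.le
  · filter_upwards [ae_arcMeasure_norm] with ζ hζ
    have haz : ‖a * ζ‖ < 1 := by rwa [norm_mul, hζ, mul_one]
    have h1 : Tendsto (fun n : ℕ => binomFun q (a * (q : ℂ) ^ n) ζ) atTop
        (𝓝 (qPochInf (q * ζ) q)) := by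
      have h := (tendsto_qPoch hq0 hq1 (a * ζ)).mul_const (binomFun q a ζ)
      rw [binomFun, mul_div_cancel₀ _ (qPochInf_ne_zero hq0 hq1 haz)] at h
      refine h.congr fun n => ?_
      rw [binomFun_shift hq0 hq1 ha hζ.le]
      rfl
    exact (h1.mul ((Complex.continuous_conj.tendsto _).comp h1)).const_mul _

/-- Iterating the shift sends the parameter to `0`, where the limiting weight does not depend on
`a`. -/
theorem weightDiff_zero_limit (hq0 : 0 < q) (hq1 : q < 1) {a : ℂ} (ha : ‖a‖ < 1) :
    qPochInf (conj a) q * qPochInf (a * q) q *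
        (circleCoeff (limitWeight q) 0 - circleCoeff (limitWeight q) (0 - 1)) =
      qPochInf (a * conj a) q * weightDiff q a 0 := by
  have h1 := ((tendsto_qPoch hq0 hq1 (conj a)).mul (tendsto_qPoch hq0 hq1 (a * q))).mul
    ((tendsto_circleCoeff_limitWeight hq0 hq1 ha 0).sub
      (tendsto_circleCoeff_limitWeight hq0 hq1 ha (0 - 1)))
  have h2 : Tendsto (fun n : ℕ => 2 * n) atTop atTop :=
    tendsto_id.const_mul_atTop' two_pos
  exact tendsto_nhds_unique (h1.congr fun n => weightDiff_zero_shift_pow hq0 hq1 ha n)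
    (((tendsto_qPoch hq0 hq1 (a * conj a)).comp h2).mul_const _)

/-- The constant in Ramanujan's bilateral summation. -/
theorem weightDiff_zero (hq0 : 0 < q) (hq1 : q < 1) {a : ℂ} (ha : ‖a‖ < 1) :
    qPochInf (conj a) q * qPochInf (a * q) q =
      qPochInf q q * qPochInf (a * conj a) q * weightDiff q a 0 := by
  have hqn := norm_ofReal_lt_one hq0 hq1
  have h1 := weightDiff_zero_limit hq0 hq1 ha
  -- For `a = q` the weight is identically `1` on the circle; this evaluates the universal constant.
  have h2 := weightDiff_zero_limit hq0 hq1 hqn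
  have hw : ∀ k, circleCoeff (weight q q) k = if k = 0 then 1 else 0 := fun k => by
    rw [circleCoeff_congr (G := fun _ => 1) (fun ζ hζ => by
      rw [weight, binomFun_self hq0 hq1 hζ.le, map_one, mul_one]) k]
    simp [circleCoeff, integral_zpow_arcMeasure, -zpow_neg]
  have h3 : weightDiff q q 0 = 1 := by simp [weightDiff, hw]
  have h4 : qPochInf ((q : ℂ) * q) q ≠ 0 := qPochInf_ne_zero hq0 hq1 (by
    have := norm_mul_pow_lt_one hq0 hq1 hqn 1
    rwa [pow_one] at this)
  rw [h3, mul_one, Complex.conj_ofReal] at h2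
  have h5 : qPochInf (q : ℂ) q * (circleCoeff (limitWeight q) 0 -
      circleCoeff (limitWeight q) (0 - 1)) = 1 := by
    refine mul_right_cancel₀ h4 ?_
    linear_combination h2
  linear_combination qPochInf (q : ℂ) q * h1 - qPochInf (conj a) q * qPochInf (a * q) q * h5

/-! ### The total mass of the weight -/

/-- The Fourier coefficients tend to `0`, so the one at `0` is minus the sum of the differences at
`1, 2, ...`. By the recurrence these are the difference at `1` times the terms of the `₂φ₁`. -/
theorem circleCoeff_weight_zero (hq0 : 0 < q) (hq1 : q < 1) {a : ℂ} (ha0 : a ≠ 0)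
    (ha : ‖a‖ < 1) :
    circleCoeff (weight q a) 0 =
      -(weightDiff q a 1 * phi21 q (q / a) (conj a * q) q a) := by
  have hca : ‖conj a‖ < 1 := by rwa [RCLike.norm_conj]
  have hcaq : ‖conj a * q‖ < 1 := by
    have := norm_mul_pow_lt_one hq0 hq1 hca 1
    rwa [pow_one] at this
  set t : ℕ → ℂ := fun n => qPoch q q n * qPoch (q / a) q n /
    (qPoch (conj a * q) q n * qPoch q q n) * a ^ n with ht
  have htr : ∀ n, (1 - conj a * (q : ℂ) ^ (n + 1)) * t (n + 1) = (a - (q : ℂ) ^ (n + 1)) * t n := by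
    intro n
    have h1 := qPoch_ne_zero hq0 hq1 hcaq n
    have h2 := qPoch_ne_zero hq0 hq1 (norm_ofReal_lt_one hq0 hq1) n
    have h3 := one_sub_mul_pow_ne_zero hq0 hq1 hcaq n
    have h4 := one_sub_mul_pow_ne_zero hq0 hq1 (norm_ofReal_lt_one hq0 hq1) n
    have h5 : conj a * (q : ℂ) ^ (n + 1) = conj a * q * (q : ℂ) ^ n := by ring
    simp only [ht]
    rw [qPoch_succ, qPoch_succ, qPoch_succ, h5]
    field_simp
    ring
  have hts : Summable t := (summable_norm_of_recurrence hq0 hq1 ha htr).of_norm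
  have hu : ∀ n : ℕ, weightDiff q a (n + 1) = weightDiff q a 1 * t n := by
    intro n
    induction n with
    | zero => simp [ht, qPoch_zero]
    | succ n ih =>
      have h1 := weightDiff_recurrence hq0 hq1 ha (n + 1)
      have h2 : 1 - conj a * (q : ℂ) ^ (n + 1) ≠ 0 := one_sub_mul_pow_ne_zero hq0 hq1 hca (n + 1)
      have h3 : (q : ℂ) ^ ((n : ℤ) + 1) = (q : ℂ) ^ (n + 1) := by
        exact_mod_cast zpow_natCast (q : ℂ) (n + 1)
      rw [h3, ih] at h1
      refine mul_left_cancel₀ h2 ?_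
      push_cast
      rw [h1]
      linear_combination -weightDiff q a 1 * htr n
  have hsum : ∀ n : ℕ, weightDiff q a 1 * ∑ j ∈ Finset.range n, t j =
      circleCoeff (weight q a) n - circleCoeff (weight q a) 0 := by
    intro n
    rw [Finset.mul_sum, ← Finset.sum_congr rfl fun j _ => hu j]
    have := Finset.sum_range_sub (fun j : ℕ => circleCoeff (weight q a) (j : ℤ)) n
    rw [Nat.cast_zero] at this
    rw [← this]
    refine Finset.sum_congr rfl fun j _ => ?_
    rw [weightDiff, add_sub_cancel_right]
    push_cast
    rfl
  have h1 := (hts.hasSum.tendsto_sum_nat.const_mul (weightDiff q a 1)).congr hsum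
  have h2 := (tendsto_circleCoeff_weight hq0 hq1 ha).sub_const (circleCoeff (weight q a) 0)
  have h3 := tendsto_nhds_unique h1 h2
  have h4 : phi21 q (q / a) (conj a * q) q a = ∑' n, t n := rfl
  rw [h4]
  linear_combination h3

theorem weight_eq_ofReal (a ζ : ℂ) : weight q a ζ = ((‖binomFun q a ζ‖ ^ 2 : ℝ) : ℂ) := by
  rw [weight, Complex.mul_conj']
  norm_cast

/-- The weight has no zeros on the circle, and the finitely many zeros of `p` are null for an
atomless measure. -/
theorem integral_normSq_mul_pos (hq0 : 0 < q) (hq1 : q < 1) {a : ℂ} (ha : ‖a‖ < 1) {p : ℂ[X]}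
    (hp : p ≠ 0) : 0 < ∫ ζ, ‖p.eval ζ‖ ^ 2 * ‖binomFun q a ζ‖ ^ 2 ∂arcMeasure := by
  have hint : Integrable (fun ζ => ‖p.eval ζ‖ ^ 2 * ‖binomFun q a ζ‖ ^ 2) arcMeasure := by
    obtain ⟨M, hM⟩ := (isCompact_sphere (0 : ℂ) 1).exists_bound_of_continuousOn
      (p.continuous.norm.pow 2).continuousOn
    have h := (integrable_weight hq0 hq1 ha).norm
    have h' : Integrable (fun ζ => ‖binomFun q a ζ‖ ^ 2) arcMeasure := by
      refine h.congr (Eventually.of_forall fun ζ => ?_)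
      simp only [weight, norm_mul, RCLike.norm_conj, sq]
    refine h'.bdd_mul (c := M) (p.continuous.norm.pow 2).aestronglyMeasurable ?_
    filter_upwards [ae_arcMeasure_norm] with ζ hζ using hM ζ (by simpa using hζ)
  rw [integral_pos_iff_support_of_nonneg (fun ζ => by positivity) hint]
  have hroots : arcMeasure (p.rootSet ℂ) = 0 :=
    (p.rootSet_finite ℂ).measure_zero _
  have hae : ∀ᵐ ζ ∂arcMeasure,
      ζ ∈ Function.support fun ζ => ‖p.eval ζ‖ ^ 2 * ‖binomFun q a ζ‖ ^ 2 := by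
    filter_upwards [ae_arcMeasure_norm, measure_eq_zero_iff_ae_notMem.mp hroots] with ζ hζ hr
    have h1 : p.eval ζ ≠ 0 := fun h => hr (by
      rw [mem_rootSet_of_ne hp, aeval_def, Algebra.algebraMap_self, eval₂_id]
      exact h)
    have h2 := binomFun_ne_zero hq0 hq1 ha hζ.le
    rw [Function.mem_support]
    positivity
  refine one_pos.trans_eq ?_
  exact ((measure_congr (eventuallyEq_univ.mpr hae)).trans measure_univ).symm

end

end QSeries

/-! ### Nonvanishing on the diagonal and initial values of the kernels. -/

namespace UnitCircle

open ComplexConjugate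

theorem cdKernel_self_ne_zero {μ : Measure ℂ} (hpos : ∀ f : ℂ[X], f ≠ 0 → pairing μ f f ≠ 0)
    (n : ℕ) (w : ℂ) : cdKernel μ n w w ≠ 0 := by
  have h : cdKernel μ n w w =
      ((∑ j ∈ Finset.range (n + 1), ‖(orthonormalOPUC μ j).eval w‖ ^ 2 : ℝ) : ℂ) := by
    rw [cdKernel, Complex.ofReal_sum]
    refine Finset.sum_congr rfl fun j _ => ?_
    rw [Complex.conj_mul']
    norm_cast
  have h0 : (orthonormalOPUC μ 0).eval w = kappa μ 0 := by
    have : monicOPUC μ 0 = 1 := by rw [monicOPUC]; simp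
    rw [orthonormalOPUC, this, mul_one, eval_C]
  have h1 : 0 < ‖(orthonormalOPUC μ 0).eval w‖ ^ 2 := by
    have := kappa_pos hpos 0
    rw [h0, Complex.norm_real, Real.norm_of_nonneg this.le]
    positivity
  have h2 := Finset.single_le_sum (f := fun j => ‖(orthonormalOPUC μ j).eval w‖ ^ 2)
    (fun j _ => sq_nonneg _) (Finset.mem_range.mpr (Nat.succ_pos n))
  rw [h]
  exact_mod_cast (h1.trans_le h2).ne'

theorem cdKernel_zero_index (μ : Measure ℂ) (z w : ℂ) :
    cdKernel μ 0 z w = ((μ.real Set.univ)⁻¹ : ℝ) := by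
  have h : monicOPUC μ 0 = 1 := by rw [monicOPUC]; simp
  have h1 : kappa μ 0 ^ 2 = (μ.real Set.univ)⁻¹ := by
    rw [kappa_sq, h]
    simp
  rw [cdKernel, Finset.sum_range_one, orthonormalOPUC, h, mul_one, eval_C, eval_C,
    Complex.conj_ofReal, ← sq, ← h1, Complex.ofReal_pow]

theorem xi_succ (μ : Measure ℂ) (n : ℕ) :
    xi μ (n + 1) = xi μ n * (2 * (1 - gParam μ (n + 1))) := by
  rw [xi, xi, Finset.prod_Icc_succ_top (by omega), mul_assoc]

end UnitCircle

/-! ### Identification of the kernels of `μ^(b)` and the connection formula. -/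

namespace QSeries

open ComplexConjugate Filter Topology UnitCircle

section

variable {q : ℝ}

/-! ### Powers of `q` -/

theorem ofReal_ne_zero (hq0 : 0 < q) : (q : ℂ) ≠ 0 := by exact_mod_cast hq0.ne'

theorem norm_cpow_eq (hq0 : 0 < q) (b : ℂ) : ‖(q : ℂ) ^ b‖ = q ^ b.re :=
  Complex.norm_cpow_eq_rpow_re_of_pos hq0 b

theorem norm_cpow_lt_one (hq0 : 0 < q) (hq1 : q < 1) {b : ℂ} (hb : 0 < b.re) :
    ‖(q : ℂ) ^ b‖ < 1 := by
  rw [norm_cpow_eq hq0]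
  exact Real.rpow_lt_one hq0.le hq1 hb

theorem cpow_ne_zero (hq0 : 0 < q) (b : ℂ) : (q : ℂ) ^ b ≠ 0 := by
  rw [Complex.cpow_def_of_ne_zero (ofReal_ne_zero hq0)]
  exact Complex.exp_ne_zero _

theorem cpow_conj_eq (hq0 : 0 < q) (b : ℂ) : (q : ℂ) ^ conj b = conj ((q : ℂ) ^ b) := by
  rw [Complex.cpow_conj _ _ (by rw [Complex.arg_ofReal_of_nonneg hq0.le]; exact Real.pi_ne_zero.symm),
    Complex.conj_ofReal]

theorem cpow_eq_exp (hq0 : 0 < q) (b : ℂ) :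
    (q : ℂ) ^ b = Complex.exp (((Real.log q : ℝ) : ℂ) * b) := by
  rw [Complex.cpow_def_of_ne_zero (ofReal_ne_zero hq0), Complex.ofReal_log hq0.le]

theorem rpow_mul_cos_etaQ (hq0 : 0 < q) (b : ℂ) :
    q ^ b.re * Real.cos (etaQ q b) = ((q : ℂ) ^ b).re := by
  rw [cpow_eq_exp hq0, Complex.exp_re, Complex.re_ofReal_mul, Complex.im_ofReal_mul,
    Real.rpow_def_of_pos hq0, etaQ, neg_mul, Real.cos_neg, mul_comm b.im]

theorem rpow_mul_sin_etaQ (hq0 : 0 < q) (b : ℂ) :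
    q ^ b.re * Real.sin (etaQ q b) = -((q : ℂ) ^ b).im := by
  rw [cpow_eq_exp hq0, Complex.exp_im, Complex.re_ofReal_mul, Complex.im_ofReal_mul,
    Real.rpow_def_of_pos hq0, etaQ, neg_mul, Real.sin_neg, mul_comm b.im, mul_neg]

theorem rpow_add_nat (hq0 : 0 < q) (x : ℝ) (n : ℕ) : q ^ (x + n) = q ^ x * q ^ n := by
  rw [Real.rpow_add hq0, Real.rpow_natCast]

theorem rpow_add_nat_succ (hq0 : 0 < q) (x : ℝ) (n : ℕ) :
    q ^ (x + n + 1) = q ^ x * q ^ (n + 1) := by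
  rw [add_assoc, ← Nat.cast_succ, rpow_add_nat hq0]

theorem rpow_two_mul (hq0 : 0 < q) (x : ℝ) : q ^ (2 * x) = (q ^ x) ^ 2 := by
  rw [mul_comm, Real.rpow_mul hq0.le]
  norm_cast

theorem cpow_add_nat_succ (hq0 : 0 < q) (b : ℂ) (n : ℕ) :
    (q : ℂ) ^ (b + n + 1) = (q : ℂ) ^ b * (q : ℂ) ^ (n + 1) := by
  rw [add_assoc, Complex.cpow_add _ _ (ofReal_ne_zero hq0), ← Nat.cast_succ, Complex.cpow_natCast]

theorem cpow_add_one (hq0 : 0 < q) (b : ℂ) : (q : ℂ) ^ (b + 1) = (q : ℂ) ^ b * q := by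
  rw [Complex.cpow_add _ _ (ofReal_ne_zero hq0), Complex.cpow_one]

/-! ### The measure -/

theorem rho_mul_circleCoeff (hq0 : 0 < q) (hq1 : q < 1) {b : ℂ} (hb : 0 < b.re) :
    rho q b * circleCoeff (weight q ((q : ℂ) ^ b)) 0 = 1 := by
  have ha0 := cpow_ne_zero hq0 b
  have ha := norm_cpow_lt_one hq0 hq1 hb
  have hq := ofReal_ne_zero hq0
  have hM : circleCoeff (weight q ((q : ℂ) ^ b)) 0 ≠ 0 := by
    have h := integral_normSq_mul_pos hq0 hq1 ha (p := 1) one_ne_zero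
    simp only [eval_one, norm_one, one_pow, one_mul] at h
    simp only [circleCoeff, neg_zero, zpow_zero, one_mul, weight_eq_ofReal, integral_complex_ofReal]
    exact_mod_cast h.ne'
  rw [rho, cpow_conj_eq hq0, cpow_add_one hq0, Complex.cpow_neg, cpow_add_one hq0,
    cpow_conj_eq hq0, Complex.cpow_add _ _ hq, cpow_conj_eq hq0, mul_comm _ (q : ℂ), ← div_eq_mul_inv]
  set a := (q : ℂ) ^ b
  have hca : ‖conj a‖ < 1 := by rwa [RCLike.norm_conj]
  have e1 := circleCoeff_weight_zero hq0 hq1 ha0 ha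
  have e2 := weightDiff_zero hq0 hq1 ha
  have e3 := weightDiff_recurrence hq0 hq1 ha 0
  have e4 := qPochInf_eq_mul hq0 hq1 a
  rw [zpow_zero, mul_one, zero_add] at e3
  have h1 := qPochInf_ne_zero hq0 hq1 ha
  have h2 := qPochInf_ne_zero hq0 hq1 hca
  have h3 := one_sub_mul_pow_ne_zero hq0 hq1 hca 0
  rw [pow_zero, mul_one] at h3
  have h4 : phi21 q (q / a) (conj a * q) q a ≠ 0 := fun h => hM (by rw [e1, h, mul_zero, neg_zero])
  rw [div_mul_div_comm, div_mul_eq_mul_div, div_eq_one_iff_eq (by positivity), e1]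
  rw [e4]
  linear_combination
    (-(qPochInf q q * qPochInf (a * conj a) q) * phi21 q (q / a) (conj a * q) q a) * e3 -
    phi21 q (q / a) (conj a * q) q a * (1 - a) * e2

/-- The product of `ρ^(b)` with a positive integral is `1`. Without this the `ENNReal.ofReal` in the
density could truncate it to zero. -/
theorem rho_re_pos (hq0 : 0 < q) (hq1 : q < 1) {b : ℂ} (hb : 0 < b.re) : 0 < (rho q b).re := by
  have h := integral_normSq_mul_pos hq0 hq1 (norm_cpow_lt_one hq0 hq1 hb) (p := 1) one_ne_zero
  have h1 := rho_mul_circleCoeff hq0 hq1 hb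
  simp only [eval_one, norm_one, one_pow, one_mul] at h
  simp only [circleCoeff, neg_zero, zpow_zero, one_mul, weight_eq_ofReal,
    integral_complex_ofReal] at h1
  have h2 := congrArg Complex.re h1
  rw [Complex.re_mul_ofReal, Complex.one_re] at h2
  exact (pos_iff_pos_of_mul_pos (by rw [h2]; exact one_pos)).mpr h

theorem qMeasure_eq (q : ℝ) (b : ℂ) :
    qMeasure q b = arcMeasure.withDensity fun ζ =>
      ENNReal.ofReal ((rho q b).re * ‖binomFun q ((q : ℂ) ^ b) ζ‖ ^ 2) := by
  simp only [qMeasure, binomFun, norm_div, div_pow]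

theorem ae_qMeasure_norm (q : ℝ) (b : ℂ) : ∀ᵐ ζ ∂(qMeasure q b), ‖ζ‖ = 1 :=
  (withDensity_absolutelyContinuous _ _).ae_le ae_arcMeasure_norm

theorem isFiniteMeasure_qMeasure (hq0 : 0 < q) (hq1 : q < 1) {b : ℂ} (hb : 0 < b.re) :
    IsFiniteMeasure (qMeasure q b) := by
  rw [qMeasure_eq]
  refine isFiniteMeasure_withDensity_ofReal ?_
  have h := (integrable_weight hq0 hq1 (norm_cpow_lt_one hq0 hq1 hb)).norm.const_mul (rho q b).re
  refine (h.congr (Eventually.of_forall fun ζ => ?_)).2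
  simp only [weight, norm_mul, RCLike.norm_conj, sq]

theorem integral_qMeasure (hq0 : 0 < q) (hq1 : q < 1) {b : ℂ} (hb : 0 < b.re)
    {E : Type*} [NormedAddCommGroup E] [NormedSpace ℝ E] (F : ℂ → E) :
    ∫ ζ, F ζ ∂(qMeasure q b) =
      ∫ ζ, ((rho q b).re * ‖binomFun q ((q : ℂ) ^ b) ζ‖ ^ 2) • F ζ ∂arcMeasure := by
  have hm : Measurable fun ζ => ENNReal.ofReal ((rho q b).re *
      ‖binomFun q ((q : ℂ) ^ b) ζ‖ ^ 2) :=
    (((measurable_binomFun hq0 hq1 _).norm.pow_const 2).const_mul _).ennreal_ofReal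
  rw [qMeasure_eq, integral_withDensity_eq_integral_toReal_smul hm
    (Eventually.of_forall fun _ => ENNReal.ofReal_lt_top)]
  congr 1
  ext ζ
  rw [ENNReal.toReal_ofReal (mul_nonneg (rho_re_pos hq0 hq1 hb).le (sq_nonneg _))]

theorem pairing_qMeasure_ne_zero (hq0 : 0 < q) (hq1 : q < 1) {b : ℂ} (hb : 0 < b.re) (f : ℂ[X])
    (hf : f ≠ 0) : pairing (qMeasure q b) f f ≠ 0 := by
  rw [pairing_self, integral_qMeasure hq0 hq1 hb]
  have h := mul_pos (rho_re_pos hq0 hq1 hb)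
    (integral_normSq_mul_pos hq0 hq1 (norm_cpow_lt_one hq0 hq1 hb) hf)
  rw [← integral_const_mul] at h
  have h2 : ∫ ζ, ((rho q b).re * ‖binomFun q ((q : ℂ) ^ b) ζ‖ ^ 2) • ‖f.eval ζ‖ ^ 2 ∂arcMeasure =
      ∫ ζ, (rho q b).re * (‖f.eval ζ‖ ^ 2 * ‖binomFun q ((q : ℂ) ^ b) ζ‖ ^ 2) ∂arcMeasure := by
    congr 1
    ext ζ
    rw [smul_eq_mul]
    ring
  rw [h2]
  exact_mod_cast h.ne'

theorem pairing_qMeasure_X_pow (hq0 : 0 < q) (hq1 : q < 1) {b : ℂ} (hb : 0 < b.re) (k j : ℕ) :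
    pairing (qMeasure q b) (X ^ k) (X ^ j) =
      (rho q b).re * circleCoeff (weight q ((q : ℂ) ^ b)) (k - j) := by
  rw [pairing, integral_qMeasure hq0 hq1 hb, circleCoeff, ← integral_const_mul]
  refine integral_congr_ae ?_
  filter_upwards [ae_arcMeasure_norm] with ζ hζ
  have h0 : ζ ≠ 0 := norm_ne_zero_iff.mp (by rw [hζ]; exact one_ne_zero)
  rw [weight_eq_ofReal, eval_pow, eval_pow, eval_X, map_pow, ← Complex.inv_eq_conj hζ, neg_sub,
    zpow_sub₀ h0, zpow_natCast, zpow_natCast, Complex.real_smul, inv_pow]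
  push_cast
  field_simp

/-! ### Identification of the kernels -/

/-- The kernel polynomials as elements of `ℂ[X]`. -/
def kernelPolynomial (q : ℝ) (a c : ℂ) (n : ℕ) : ℂ[X] :=
  ∑ j ∈ Finset.range (n + 1), C (qBinom a q j * qBinom c q (n - j)) * X ^ j

theorem eval_kernelPolynomial (q : ℝ) (a c : ℂ) (n : ℕ) (z : ℂ) :
    (kernelPolynomial q a c n).eval z = kernelPoly q a c n z := by
  simp only [kernelPolynomial, kernelPoly, eval_finsetSum, eval_mul, eval_C, eval_pow, eval_X]

theorem degree_kernelPolynomial_lt (q : ℝ) (a c : ℂ) (n : ℕ) :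
    (kernelPolynomial q a c n).degree < ((n + 1 : ℕ) : WithBot ℕ) := by
  refine (degree_sum_le _ _).trans_lt ((Finset.sup_lt_iff (WithBot.bot_lt_coe _)).mpr fun j hj => ?_)
  exact (degree_C_mul_X_pow_le _ _).trans_lt (WithBot.coe_lt_coe.mpr (Finset.mem_range.mp hj))

theorem pairing_X_pow_kernelPolynomial (hq0 : 0 < q) (hq1 : q < 1) {b : ℂ} (hb : 0 < b.re)
    {n k : ℕ} (hk : k ≤ n) :
    pairing (qMeasure q b) (X ^ k)
        (kernelPolynomial q ((q : ℂ) ^ b) (conj ((q : ℂ) ^ b)) n) =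
      pairing (qMeasure q b) (X ^ 0)
        (kernelPolynomial q ((q : ℂ) ^ b) (conj ((q : ℂ) ^ b)) n) := by
  have := isFiniteMeasure_qMeasure hq0 hq1 hb
  have hT := ae_qMeasure_norm q b
  have ha := norm_cpow_lt_one hq0 hq1 hb
  induction k with
  | zero => rfl
  | succ k ih =>
    rw [← ih (by omega), ← sub_eq_zero, kernelPolynomial, pairing_sum_right hT,
      pairing_sum_right hT, ← Finset.sum_sub_distrib]
    have h := sum_qBinom_mul_eq_zero hq0 hq1 (by rwa [RCLike.norm_conj])
      (weightDiff_recurrence hq0 hq1 ha) (n := n) (m := k) (by omega)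
    rw [← mul_zero ((rho q b).re : ℂ), ← h, Finset.mul_sum]
    refine Finset.sum_congr rfl fun j _ => ?_
    rw [pairing_C_mul_right hT, pairing_C_mul_right hT, pairing_qMeasure_X_pow hq0 hq1 hb,
      pairing_qMeasure_X_pow hq0 hq1 hb, weightDiff]
    have e1 : (((k + 1 : ℕ) : ℤ) - j : ℤ) = k + 1 - j := by push_cast; ring
    have e2 : ((k : ℤ) + 1 - j - 1 : ℤ) = k - j := by ring
    rw [e1, e2]
    ring

theorem conj_qPoch (a : ℂ) (q : ℝ) (n : ℕ) : conj (qPoch a q n) = qPoch (conj a) q n := by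
  simp [qPoch, map_prod]

/-- Conjugation exchanges the parameters `a` and `conj a`, and the substitution `j ↦ n - j`
exchanges them back. This makes the factor between `kernelPoly` and the kernel real, as required for
taking real parts later. -/
theorem conj_kernelPoly_one (q : ℝ) (a : ℂ) (n : ℕ) :
    conj (kernelPoly q a (conj a) n 1) = kernelPoly q a (conj a) n 1 := by
  simp only [kernelPoly, one_pow, mul_one, map_sum, map_mul]
  rw [← Finset.sum_range_reflect]
  refine Finset.sum_congr rfl fun j hj => ?_
  have hj' := Finset.mem_range.mp hj
  rw [show n + 1 - 1 - j = n - j by omega, show n - (n - j) = j by omega]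
  simp only [qBinom, map_div₀, conj_qPoch, Complex.conj_conj, Complex.conj_ofReal]
  ring

theorem exists_cdKernel_qMeasure_eq (hq0 : 0 < q) (hq1 : q < 1) {b : ℂ} (hb : 0 < b.re) (n : ℕ) :
    ∃ d : ℝ, d ≠ 0 ∧ ∀ z, cdKernel (qMeasure q b) n z 1 =
      d * kernelPoly q ((q : ℂ) ^ b) (conj ((q : ℂ) ^ b)) n z := by
  have := isFiniteMeasure_qMeasure hq0 hq1 hb
  have hT := ae_qMeasure_norm q b
  have hpos := pairing_qMeasure_ne_zero hq0 hq1 hb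
  set a := (q : ℂ) ^ b with ha_def
  have ha := norm_cpow_lt_one hq0 hq1 hb
  set P := kernelPolynomial q a (conj a) n with hP
  have hdeg : P.degree < ((n + 1 : ℕ) : WithBot ℕ) := degree_kernelPolynomial_lt q a (conj a) n
  have hrep : ∀ f : ℂ[X], f.degree < ((n + 1 : ℕ) : WithBot ℕ) →
      pairing (qMeasure q b) P f = pairing (qMeasure q b) P (X ^ 0) * f.eval 1 := by
    intro f hf
    have hf' : f.natDegree < n + 1 :=
      Nat.lt_succ_iff.mpr (natDegree_le_iff_degree_le.mpr (Order.lt_succ_iff.mp hf))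
    conv_lhs => rw [f.as_sum_range_C_mul_X_pow' hf']
    rw [pairing_sum_right hT, eval_eq_sum_range' hf', Finset.mul_sum]
    refine Finset.sum_congr rfl fun k hk => ?_
    rw [pairing_C_mul_right hT, ← pairing_conj _ (X ^ k), pairing_X_pow_kernelPolynomial hq0 hq1 hb
      (Nat.lt_succ_iff.mp (Finset.mem_range.mp hk)), pairing_conj, one_pow, mul_one, mul_comm]
  set c := pairing (qMeasure q b) P (X ^ 0)
  have hker : ∀ z, kernelPoly q a (conj a) n z = conj c * cdKernel (qMeasure q b) n z 1 := by
    intro z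
    rw [← eval_kernelPolynomial]
    exact eval_eq_mul_cdKernel hT hpos hdeg hrep z
  have hK := cdKernel_self_ne_zero hpos n 1
  have hP0 : P ≠ 0 := by
    intro h
    have h1 := eval_kernelPolynomial q a (conj a) n 0
    rw [← hP, h, eval_zero, kernelPoly, Finset.sum_range_succ'] at h1
    simp only [ne_eq, Nat.add_eq_zero_iff, one_ne_zero, and_false, not_false_eq_true, zero_pow,
      mul_zero, Finset.sum_const_zero, pow_zero, mul_one, zero_add, qBinom_zero, one_mul,
      Nat.sub_zero] at h1
    exact div_ne_zero (qPoch_ne_zero hq0 hq1 (by rwa [RCLike.norm_conj]) n)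
      (qPoch_ne_zero hq0 hq1 (norm_ofReal_lt_one hq0 hq1) n) h1.symm
  -- If `c` were zero, then `P` would be orthogonal to itself.
  have hc : c ≠ 0 := by
    intro h
    have h1 := hrep P hdeg
    rw [h, zero_mul] at h1
    exact hpos P hP0 h1
  have hreal : conj c = c := by
    have h1 := conj_kernelPoly_one q a n
    rw [hker, map_mul, cdKernel_conj] at h1
    have h2 := mul_right_cancel₀ hK h1
    rw [Complex.conj_conj] at h2
    exact h2.symm
  obtain ⟨r, hr⟩ := Complex.conj_eq_iff_real.mp hreal
  have hr0 : (r : ℂ) ≠ 0 := by rwa [← hr]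
  refine ⟨r⁻¹, inv_ne_zero (by exact_mod_cast hr0), fun z => ?_⟩
  rw [hker, hreal, hr, Complex.ofReal_inv, inv_mul_cancel_left₀ hr0]

theorem kernelPoly_zero_right (q : ℝ) (a c : ℂ) (n : ℕ) :
    kernelPoly q a c n 0 = qBinom c q n := by
  rw [kernelPoly, Finset.sum_range_succ']
  simp [qBinom_zero]

theorem re_lt_one_of_norm {a : ℂ} (ha : ‖a‖ < 1) : ‖((a.re : ℝ) : ℂ)‖ < 1 := by
  rw [Complex.norm_real]
  exact (Complex.abs_re_le_norm a).trans_lt ha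

theorem normalizedKernel_qMeasure (hq0 : 0 < q) (hq1 : q < 1) {b : ℂ} (hb : 0 < b.re) (n : ℕ)
    (z : ℂ) :
    normalizedKernel (qMeasure q b) n z = qPoch q q n / qPoch (((q : ℂ) ^ b).re : ℂ) q n *
      kernelPoly q ((q : ℂ) ^ b) (conj ((q : ℂ) ^ b)) n z := by
  have := isFiniteMeasure_qMeasure hq0 hq1 hb
  have hT := ae_qMeasure_norm q b
  have hpos := pairing_qMeasure_ne_zero hq0 hq1 hb
  choose d hd0 hd using exists_cdKernel_qMeasure_eq hq0 hq1 hb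
  have ha := norm_cpow_lt_one hq0 hq1 hb
  set a := (q : ℂ) ^ b
  have hca : ‖conj a‖ < 1 := by rwa [RCLike.norm_conj]
  suffices h : ((xi (qMeasure q b) n * d n : ℝ) : ℂ) = qPoch q q n / qPoch (a.re : ℂ) q n by
    rw [normalizedKernel, hd, ← h, Complex.ofReal_mul, mul_assoc]
  induction n with
  | zero =>
    have h1 := hd 0 0
    rw [cdKernel_zero_index, kernelPoly_zero_right, qBinom_zero, mul_one] at h1
    have h2 : (qMeasure q b).real Set.univ ≠ 0 := by
      intro h
      rw [h, inv_zero] at h1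
      exact hd0 0 (by exact_mod_cast h1.symm)
    have h3 : d 0 = ((qMeasure q b).real Set.univ)⁻¹ := by exact_mod_cast h1.symm
    have h4 : xi (qMeasure q b) 0 = (qMeasure q b).real Set.univ := by simp [xi]
    rw [h3, h4, mul_inv_cancel₀ h2, qPoch_zero, qPoch_zero]
    simp
  | succ n ih =>
    have hb1 : ∀ m, qBinom (conj a) q m ≠ 0 := fun m =>
      div_ne_zero (qPoch_ne_zero hq0 hq1 hca m)
        (qPoch_ne_zero hq0 hq1 (norm_ofReal_lt_one hq0 hq1) m)
    have hdc : ∀ m, (d m : ℂ) ≠ 0 := fun m => by exact_mod_cast hd0 m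
    have hK : ∀ m, cdKernel (qMeasure q b) m 0 1 = d m * qBinom (conj a) q m := fun m => by
      rw [hd, kernelPoly_zero_right]
    have hq' := one_sub_pow_succ_ne_zero hq0 hq1 n
    have hqr : 1 - q ^ (n + 1) ≠ 0 := by exact_mod_cast hq'
    have har := one_sub_mul_pow_ne_zero hq0 hq1 (re_lt_one_of_norm ha) n
    have harr : 1 - a.re * q ^ n ≠ 0 := by exact_mod_cast har
    have h := re_two_mul_one_sub_gParam hT hpos n
      (by rw [hK]; exact mul_ne_zero (hdc n) (hb1 n))
    have hratio : cdKernel (qMeasure q b) (n + 1) 0 1 / cdKernel (qMeasure q b) n 0 1 =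
        ((d (n + 1) / d n / (1 - q ^ (n + 1)) : ℝ) : ℂ) * (1 - conj a * (q : ℂ) ^ n) := by
      have h1 := qBinom_succ hq0 hq1 (conj a) n
      have h2 := hb1 n
      have h3 := hdc n
      rw [hK, hK]
      push_cast
      field_simp
      linear_combination (d (n + 1) : ℂ) * h1
    have hre : (1 - conj a * (q : ℂ) ^ n).re = 1 - a.re * q ^ n := by
      rw [← Complex.ofReal_pow, Complex.sub_re, Complex.re_mul_ofReal, Complex.conj_re,
        Complex.one_re]
    -- The factor `d (n+1) / d n` is real, so the normalisation of real parts determines it together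
    -- with `2(1-g_{n+1})`.
    rw [hratio, Complex.re_ofReal_mul, hre] at h
    have h5 : xi (qMeasure q b) (n + 1) * d (n + 1) =
        xi (qMeasure q b) n * d n * ((1 - q ^ (n + 1)) / (1 - a.re * q ^ n)) := by
      have h3 := hd0 n
      rw [xi_succ]
      field_simp at h ⊢
      linear_combination xi (qMeasure q b) n * h
    rw [h5, Complex.ofReal_mul, ih, qPoch_succ, qPoch_succ]
    push_cast
    rw [div_mul_div_comm, pow_succ']

theorem explicitKernel_eq (hq0 : 0 < q) (hq1 : q < 1) {b : ℂ} (hb : 0 < b.re) (n : ℕ) (z : ℂ) :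
    explicitKernel q b n z = qPoch q q n / qPoch (((q : ℂ) ^ b).re : ℂ) q n *
      kernelPoly q ((q : ℂ) ^ b) (conj ((q : ℂ) ^ b)) n z := by
  have hq := ofReal_ne_zero hq0
  have ha := norm_cpow_lt_one hq0 hq1 hb
  have ha0 := cpow_ne_zero hq0 b
  have e1 : (q : ℂ) ^ (-(n : ℂ)) = ((q : ℂ) ^ n)⁻¹ := by
    rw [Complex.cpow_neg, Complex.cpow_natCast]
  have e2 : (q : ℂ) ^ (-conj b - n + 1) = q / (conj ((q : ℂ) ^ b) * (q : ℂ) ^ n) := by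
    rw [cpow_add_one hq0, Complex.cpow_sub _ _ hq, Complex.cpow_neg, cpow_conj_eq hq0,
      Complex.cpow_natCast]
    field_simp
  have e3 : (q : ℂ) ^ (-conj b + 1) = q / conj ((q : ℂ) ^ b) := by
    rw [cpow_add_one hq0, Complex.cpow_neg, cpow_conj_eq hq0]
    field_simp
  rw [explicitKernel, e1, e2, e3, cpow_conj_eq hq0, rpow_mul_cos_etaQ hq0, div_mul_eq_mul_div,
    qPoch_mul_phi21 hq0 hq1 _ (by simpa using ha0) (by rwa [RCLike.norm_conj]), div_mul_eq_mul_div]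

/-! ### The connection formula -/

theorem normalizedKernel_connection (hq0 : 0 < q) (hq1 : q < 1) {b : ℂ} (hb : 0 < b.re) (n : ℕ)
    (z : ℂ) :
    gammaCoeff q b n * quadG ((q : ℂ) ^ (-b)) ((q : ℂ) ^ conj b) z *
        normalizedKernel (qMeasure q (b + 1)) n z =
      normalizedKernel (qMeasure q b) (n + 2) z +
        coeffA1 q b n * normalizedKernel (qMeasure q b) (n + 1) z +
        coeffA2 q b n * z * normalizedKernel (qMeasure q b) n z := by
  have hb1 : 0 < (b + 1).re := by
    rw [Complex.add_re, Complex.one_re]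
    linarith
  have ha0 := cpow_ne_zero hq0 b
  have ha := norm_cpow_lt_one hq0 hq1 hb
  rw [normalizedKernel_qMeasure hq0 hq1 hb1, normalizedKernel_qMeasure hq0 hq1 hb,
    normalizedKernel_qMeasure hq0 hq1 hb, normalizedKernel_qMeasure hq0 hq1 hb, cpow_add_one hq0,
    Complex.re_mul_ofReal, map_mul, Complex.conj_ofReal]
  have hcos : ∀ x : ℝ, q ^ b.re * x * Real.cos (etaQ q b) = ((q : ℂ) ^ b).re * x := fun x => by
    rw [← rpow_mul_cos_etaQ hq0]
    ring
  have hG : quadG ((q : ℂ) ^ (-b)) ((q : ℂ) ^ conj b) z =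
      -(conj ((q : ℂ) ^ b))⁻¹ * (z - ((q : ℂ) ^ b)⁻¹) * (z - conj ((q : ℂ) ^ b)) := by
    rw [quadG, Complex.cpow_neg, cpow_conj_eq hq0]
  rw [hG, gammaCoeff, coeffA1, coeffA2, rpow_add_nat_succ hq0, rpow_add_nat_succ hq0,
    rpow_add_nat hq0, rpow_add_nat hq0, rpow_mul_sin_etaQ hq0, rpow_mul_cos_etaQ hq0,
    rpow_two_mul hq0, hcos, hcos, ← norm_cpow_eq hq0, cpow_conj_eq hq0, cpow_add_nat_succ hq0,
    Complex.cpow_neg]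
  set a := (q : ℂ) ^ b
  have hca : ‖conj a‖ < 1 := by rwa [RCLike.norm_conj]
  have hca0 : conj a ≠ 0 := by simpa using ha0
  have hr := re_lt_one_of_norm ha
  have h1 := qPoch_ne_zero hq0 hq1 hr n
  have h2 := one_sub_mul_pow_ne_zero hq0 hq1 hr n
  have h3 := one_sub_mul_pow_ne_zero hq0 hq1 hr (n + 1)
  have h4 := one_sub_mul_pow_ne_zero hq0 hq1 hca 0
  have h5 := one_sub_mul_pow_ne_zero hq0 hq1 hr 0
  rw [pow_zero, mul_one] at h4 h5
  have hnorm : ((‖a‖ : ℝ) : ℂ) ^ 2 = a * conj a := (Complex.mul_conj' a).symm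
  have him : 2 * Complex.I * (-a.im : ℂ) = conj a - a := by
    have h := Complex.sub_conj a
    push_cast at h
    linear_combination h
  have hp := qPoch_succ' (a.re : ℂ) q n
  rw [qPoch_succ] at hp
  -- For the parameter `b+1` the real part is `q Re a`; this brings its normalising product to the
  -- base parameter `Re a`.
  have h6 : qPoch ((a.re : ℂ) * q) q n =
      qPoch (a.re : ℂ) q n * (1 - a.re * (q : ℂ) ^ n) / (1 - a.re) := by
    rw [eq_div_iff h5]
    linear_combination -hp
  have hmain := kernelPoly_connection hq0 hq1 a (conj a) z n
  have e1 : (q : ℂ) * (q : ℂ) ^ n = (q : ℂ) ^ (n + 1) := (pow_succ' _ _).symm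
  have e2 : (q : ℂ) * (q : ℂ) ^ (n + 1) = (q : ℂ) ^ (n + 2) := (pow_succ' _ _).symm
  rw [Complex.ofReal_mul, h6, qPoch_succ _ _ (n + 1), qPoch_succ _ _ (n + 1), qPoch_succ _ _ n,
    qPoch_succ _ _ n, e1, e2]
  push_cast
  rw [hnorm, him]
  -- What remains is a rational identity in these quantities, so they are treated as independent
  -- variables before denominators are cleared.
  generalize kernelPoly q (a * q) (conj a * q) n z = K₀ at *
  generalize kernelPoly q a (conj a) (n + 2) z = K₃ at *
  generalize kernelPoly q a (conj a) (n + 1) z = K₂ at *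
  generalize kernelPoly q a (conj a) n z = K₁ at *
  generalize (q : ℂ) ^ (n + 2) = x₂ at *
  generalize (q : ℂ) ^ (n + 1) = x₁ at *
  generalize (q : ℂ) ^ n = x₀ at *
  generalize 1 - (a.re : ℂ) * x₀ = d₀ at *
  generalize 1 - (a.re : ℂ) * x₁ = d₁ at *
  generalize 1 - (a.re : ℂ) = d at *
  field_simp
  linear_combination qPoch q q n * hmain

end

end QSeries

end

theorem mainTheorem8 (q : ℝ) (hq0 : 0 < q) (hq1 : q < 1) (b : ℂ) (hb : 0 < b.re) :
    (∀ (n : ℕ) (z : ℂ),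
      UnitCircle.normalizedKernel (QSeries.qMeasure q b) n z = QSeries.explicitKernel q b n z) ∧
    (∀ (n : ℕ) (z : ℂ),
      QSeries.gammaCoeff q b n *
          QSeries.quadG ((q : ℂ) ^ (-b)) ((q : ℂ) ^ (starRingEnd ℂ b)) z *
          UnitCircle.normalizedKernel (QSeries.qMeasure q (b + 1)) n z =
        UnitCircle.normalizedKernel (QSeries.qMeasure q b) (n + 2) z +
          QSeries.coeffA1 q b n *
            UnitCircle.normalizedKernel (QSeries.qMeasure q b) (n + 1) z +
          QSeries.coeffA2 q b n * z *
            UnitCircle.normalizedKernel (QSeries.qMeasure q b) n z) := by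
  exact ⟨fun n z => by
    rw [QSeries.normalizedKernel_qMeasure hq0 hq1 hb, QSeries.explicitKernel_eq hq0 hq1 hb],
    QSeries.normalizedKernel_connection hq0 hq1 hb⟩
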